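/- Let $R$ be a local commutative ring whose maximal ideal $\mathfrak m$ is principal and satisfies $\mathfrak m^2=0$. A chain complex means a non-negatively graded chain complex of $R$-modules (with differential lowering the degree). A chain complex $X$ is called perfect if each $X_n$ is projective and $\bigoplus_n X_n$ is finitely generated. For a chain complex $A$, let $\mathcal C(A)$ be the smallest collection of chain complexes that contains $A$, is closed under arbitrary direct sums and under weak equivalences (i.e. if there is a chain map $V\to W$ inducing an isomorphism on all homology, then $V\in\mathcal C(A)$ if and only if $W\in\mathcal C(A)$), and has the property that if $0\to U\to V\to W\to 0$ is an exact sequence of chain complexes with $U,V\in\mathcal C(A)$, then $W\in\mathcal C(A)$. A chain complex $Y$ is called $A$-cellular if $Y\in\mathcal C(A)$. Let $X$ be a perfect chain complex with $H_0(X)\neq 0$, and let $Y$ be any chain complex. Then $Y$ is $X$-cellular if and only if there are a set $I$ and a chain map $f:\bigoplus_{i\in I}X\to Y$ such that $H_0(f):H_0\big(\bigoplus_{i\in I}X\big)\to H_0(Y)$ is surjective. -/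

import Mathlib

open CategoryTheory CategoryTheory.Limits

universe u

namespace CellularComplexes

/-- The category of non-negatively graded chain complexes of `R`-modules. -/
abbrev Ch (R : Type u) [CommRing R] : Type (u + 1) :=
  ChainComplex (ModuleCat.{u} R) ℕ

variable {R : Type u} [CommRing R]

/-- A chain complex is cofibrant if it is degreewise projective. -/
def IsCofibrant (X : Ch R) : Prop :=
  ∀ n : ℕ, Module.Projective R (X.X n)

/-- A chain complex is perfect if it is cofibrant and the direct sum of all its terms is a
finitely generated module. -/
structure IsPerfect (X : Ch R) : Prop where
  isCofibrant : IsCofibrant X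
  finite : Module.Finite R (DirectSum ℕ fun n => (X.X n : Type u))

/-- `IsCellular A` is the smallest collection of chain complexes that contains `A`, is closed
under arbitrary (small) direct sums and under weak equivalences (homology isomorphisms, in both
directions), and contains `Z` whenever there is a short exact sequence `0 ⟶ X ⟶ Y ⟶ Z ⟶ 0` with
`X` and `Y` in the collection. -/
inductive IsCellular (A : Ch R) : Ch R → Prop
  | self : IsCellular A A
  | sum (I : Type u) (X : I → Ch R) (hX : ∀ i : I, IsCellular A (X i)) : IsCellular A (∐ X)
  | weakEquiv_target {X Y : Ch R} (f : X ⟶ Y) (hf : QuasiIso f) (hX : IsCellular A X) :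
      IsCellular A Y
  | weakEquiv_source {X Y : Ch R} (f : X ⟶ Y) (hf : QuasiIso f) (hY : IsCellular A Y) :
      IsCellular A X
  | quotient (S : ShortComplex (Ch R)) (hS : S.ShortExact) (hX : IsCellular A S.X₁)
      (hY : IsCellular A S.X₂) : IsCellular A S.X₃

end CellularComplexes

/-! Necessity: let `IsGeneratedBy X Y` say that maps `X ⟶ Y` together generate `H₀(Y)`. This
property survives every closure operation. Only the passage to the source of a weak equivalence is
not formal; there degreewise projectivity of `X` lets maps be lifted, up to boundaries in degree
zero (`exists_lift_of_quasiIso`).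

Sufficiency: write the maximal ideal as `(p)` with `p² = 0`, and let `K_n` be the complex `R ← R ← ⋯
← R` in degrees `0, …, n` with every differential equal to `p`. The first point is that `X` may be
replaced by some `K_n` (`exists_seg_of_finite`). Splitting off contractible summands makes `X`
minimal, so `d = p δ`. If `n` is such that the composite of the `δ`s from `X_n` to `X_0` is onto but
the one from `X_{n+1}` is not, then `K_n` is a retract of `X`, and every element of `X_0` is the
image of `1` under a map from `K_n`. So `K_n` is `X`-cellular and generates `H₀(Y)` whenever `X`
does.

The second point is that `K_n` builds every such `Y` (`IsCellular.of_seg`). For `n = 0` it is the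
ring in degree zero and builds everything through free resolutions. For `n ≥ 1`, stacking shifted
copies of `K_n` gives the infinite complex `K_∞`, and the cofibre of a map `K_∞ → K_∞[1]` up to weak
equivalence is `R[1]`. Hence `R[1]`, and with it every complex with `H₀ = 0`, is cellular. Moreover
`p` kills `H₀(Y)`, so `H₀(Y)` is a vector space over the residue field. A sum of copies of `K_n`
indexed by a basis, plus copies of `R[1]` hitting all 1-cycles, maps to `Y` bijectively on `H₀` and
onto `H₁`. Its homotopy fibre has `H₀ = 0`, so the fibre is cellular, and therefore so is `Y`
(`IsCellular.of_fiber`). -/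

namespace CellularComplexes
variable {R : Type u} [CommRing R]

/-! ### Homology in terms of elements -/

/-- An element of a chain complex that is killed by the differential. -/
def IsCycle (K : Ch R) (i : ℕ) (x : K.X i) : Prop := ∀ j, (K.d i j).hom x = 0

theorem isCycle_zero (K : Ch R) (x : K.X 0) : IsCycle K 0 x := fun j => by
  rw [K.shape 0 j (by simp)]; rfl

theorem isCycle_succ {K : Ch R} {i : ℕ} {x : K.X (i + 1)} (h : (K.d (i + 1) i).hom x = 0) :
    IsCycle K (i + 1) x := fun j => by
  by_cases hj : j = i
  · subst hj; exact h
  · rw [K.shape (i + 1) j (by simp; omega)]; rfl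

theorem d_d_apply (K : Ch R) (i j k : ℕ) (x : K.X i) :
    (K.d j k).hom ((K.d i j).hom x) = 0 := by
  have := K.d_comp_d i j k
  exact congrArg (fun f => f.hom x) this

theorem isCycle_d {K : Ch R} (i j : ℕ) (x : K.X i) : IsCycle K j ((K.d i j).hom x) :=
  fun k => d_d_apply K i j k x

theorem hom_d_apply {V W : Ch R} (f : V ⟶ W) (i j : ℕ) (x : V.X i) :
    (W.d i j).hom ((f.f i).hom x) = (f.f j).hom ((V.d i j).hom x) :=
  congrArg (fun f => f.hom x) (f.comm i j)

theorem IsCycle.map {V W : Ch R} (f : V ⟶ W) {i : ℕ} {x : V.X i} (h : IsCycle V i x) :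
    IsCycle W i ((f.f i).hom x) := fun j => by
  rw [hom_d_apply, h j, map_zero]

/-- A chain map given by linear maps. -/
def homMk {V W : Ch R} (f : ∀ i, V.X i →ₗ[R] W.X i)
    (h : ∀ i x, (W.d (i + 1) i).hom (f (i + 1) x) = f i ((V.d (i + 1) i).hom x)) : V ⟶ W where
  f i := ModuleCat.ofHom (f i)
  comm' := by
    rintro _ j rfl
    ext x
    exact h j x

@[simp] theorem homMk_f {V W : Ch R} (f : ∀ i, V.X i →ₗ[R] W.X i) (h) (i : ℕ) :
    ((homMk (V := V) (W := W) f h).f i).hom = f i := rfl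

theorem exists_cycles {K : Ch R} {i : ℕ} {x : K.X i} (hx : IsCycle K i x) :
    ∃ z : K.cycles i, (K.iCycles i).hom z = x := by
  have := ShortComplex.exact_of_f_is_kernel (ShortComplex.mk _ _ (K.sc i).iCycles_g)
    (K.sc i).cyclesIsKernel
  rw [ShortComplex.moduleCat_exact_iff] at this
  exact this x (hx _)

theorem isCycle_iCycles {K : Ch R} {i : ℕ} (z : K.cycles i) :
    IsCycle K i ((K.iCycles i).hom z) := fun j =>
  congrArg (fun f => f.hom z) (K.iCycles_d i j)

theorem iCycles_injective (K : Ch R) (i : ℕ) : Function.Injective (K.iCycles i).hom :=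
  (ModuleCat.mono_iff_injective _).1 inferInstance

theorem homologyπ_surjective (K : Ch R) (i : ℕ) : Function.Surjective (K.homologyπ i).hom :=
  (ModuleCat.epi_iff_surjective _).1 inferInstance

theorem homologyπ_eq_zero_iff {K : Ch R} {i : ℕ} (z : K.cycles i) :
    (K.homologyπ i).hom z = 0 ↔ ∃ y, (K.d (i + 1) i).hom y = (K.iCycles i).hom z := by
  have hex := ShortComplex.exact_of_g_is_cokernel
    (ShortComplex.mk _ _ (K.toCycles_comp_homologyπ (i + 1) i))
    (K.homologyIsCokernel (i + 1) i (by simp))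
  rw [ShortComplex.moduleCat_exact_iff] at hex
  have ht (y) : (K.iCycles i).hom ((K.toCycles (i + 1) i).hom y) = (K.d (i + 1) i).hom y :=
    congrArg (fun f => f.hom y) (K.toCycles_i (i + 1) i)
  constructor
  · intro h
    obtain ⟨y, hy⟩ := hex z h
    refine ⟨y, ?_⟩
    rw [← ht]
    exact congrArg _ hy
  · rintro ⟨y, hy⟩
    rw [← ht] at hy
    rw [← iCycles_injective K i hy]
    exact congrArg (fun f => f.hom y) (K.toCycles_comp_homologyπ (i + 1) i)

theorem homologyMap_surjective_iff {V W : Ch R} (f : V ⟶ W) (i : ℕ) :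
    Function.Surjective (HomologicalComplex.homologyMap f i).hom ↔
      ∀ w, IsCycle W i w → ∃ v, IsCycle V i v ∧ ∃ w',
        w = (f.f i).hom v + (W.d (i + 1) i).hom w' := by
  have hn (z) : (HomologicalComplex.homologyMap f i).hom ((V.homologyπ i).hom z) =
      (W.homologyπ i).hom ((HomologicalComplex.cyclesMap f i).hom z) :=
    congrArg (fun f => f.hom z) (HomologicalComplex.homologyπ_naturality f i)
  have hc (z) : (W.iCycles i).hom ((HomologicalComplex.cyclesMap f i).hom z) =
      (f.f i).hom ((V.iCycles i).hom z) :=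
    congrArg (fun f => f.hom z) (HomologicalComplex.cyclesMap_i f i)
  constructor
  · intro h w hw
    obtain ⟨z, rfl⟩ := exists_cycles hw
    obtain ⟨c, hc'⟩ := h ((W.homologyπ i).hom z)
    obtain ⟨v, rfl⟩ := homologyπ_surjective V i c
    rw [hn, eq_comm, ← sub_eq_zero, ← map_sub, homologyπ_eq_zero_iff] at hc'
    obtain ⟨w', hw'⟩ := hc'
    refine ⟨_, isCycle_iCycles v, w', ?_⟩
    rw [hw', map_sub, hc]; abel
  · intro h c
    obtain ⟨z, rfl⟩ := homologyπ_surjective W i c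
    obtain ⟨v, hv, w', hw'⟩ := h _ (isCycle_iCycles z)
    obtain ⟨v, rfl⟩ := exists_cycles hv
    refine ⟨(V.homologyπ i).hom v, ?_⟩
    rw [hn, eq_comm, ← sub_eq_zero, ← map_sub, homologyπ_eq_zero_iff]
    exact ⟨w', by rw [map_sub, hw', hc]; abel⟩

theorem homologyMap_injective_iff {V W : Ch R} (f : V ⟶ W) (i : ℕ) :
    Function.Injective (HomologicalComplex.homologyMap f i).hom ↔
      ∀ v, IsCycle V i v → ∀ w', (W.d (i + 1) i).hom w' = (f.f i).hom v →
        ∃ v', (V.d (i + 1) i).hom v' = v := by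
  have hn (z) : (HomologicalComplex.homologyMap f i).hom ((V.homologyπ i).hom z) =
      (W.homologyπ i).hom ((HomologicalComplex.cyclesMap f i).hom z) :=
    congrArg (fun f => f.hom z) (HomologicalComplex.homologyπ_naturality f i)
  have hc (z) : (W.iCycles i).hom ((HomologicalComplex.cyclesMap f i).hom z) =
      (f.f i).hom ((V.iCycles i).hom z) :=
    congrArg (fun f => f.hom z) (HomologicalComplex.cyclesMap_i f i)
  rw [injective_iff_map_eq_zero]
  constructor
  · intro h v hv w' hw'
    obtain ⟨z, rfl⟩ := exists_cycles hv
    apply (homologyπ_eq_zero_iff z).1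
    apply h
    rw [hn, homologyπ_eq_zero_iff]
    exact ⟨w', by rw [hw', hc]⟩
  · intro h c hc'
    obtain ⟨z, rfl⟩ := homologyπ_surjective V i c
    rw [hn, homologyπ_eq_zero_iff] at hc'
    obtain ⟨w', hw'⟩ := hc'
    exact (homologyπ_eq_zero_iff z).2 (h _ (isCycle_iCycles z) w' (by rw [hw', hc]))

theorem quasiIso_iff_bijective {V W : Ch R} (f : V ⟶ W) :
    QuasiIso f ↔ ∀ i, Function.Bijective (HomologicalComplex.homologyMap f i).hom := by
  rw [quasiIso_iff]
  refine forall_congr' fun i => ?_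
  rw [quasiIsoAt_iff_isIso_homologyMap, ConcreteCategory.isIso_iff_bijective]

theorem epi_homologyMap_zero_iff {V W : Ch R} (f : V ⟶ W) :
    Epi (HomologicalComplex.homologyMap f 0) ↔
      ∀ w, ∃ v w', w = (f.f 0).hom v + (W.d 1 0).hom w' := by
  rw [ModuleCat.epi_iff_surjective]
  refine (homologyMap_surjective_iff f 0).trans ⟨fun h w => ?_, fun h w _ => ?_⟩
  · obtain ⟨v, -, hv⟩ := h w (isCycle_zero W w)
    exact ⟨v, hv⟩
  · obtain ⟨v, hv⟩ := h w
    exact ⟨v, isCycle_zero V v, hv⟩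

theorem not_isZero_homology_zero_iff (K : Ch R) :
    ¬ IsZero (K.homology 0) ↔ ∃ x, ∀ y, (K.d 1 0).hom y ≠ x := by
  rw [← not_iff_not]
  push Not
  rw [ModuleCat.isZero_iff_subsingleton]
  constructor
  · intro h x
    obtain ⟨z, rfl⟩ := exists_cycles (isCycle_zero K x)
    exact (homologyπ_eq_zero_iff z).1 (Subsingleton.elim _ _)
  · intro h
    refine subsingleton_of_forall_eq 0 fun c => ?_
    obtain ⟨z, rfl⟩ := homologyπ_surjective K 0 c
    exact (homologyπ_eq_zero_iff z).2 (h _)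

/-! ### Criteria for weak equivalences -/

/-- Every cycle is a boundary. -/
def IsAcyclic (K : Ch R) : Prop :=
  ∀ i x, IsCycle K i x → ∃ y, (K.d (i + 1) i).hom y = x

theorem quasiIso_of_bijective {V W : Ch R} (f : V ⟶ W)
    (h : ∀ i, Function.Bijective (f.f i).hom) : QuasiIso f := by
  rw [quasiIso_iff_bijective]
  refine fun i => ⟨(homologyMap_injective_iff f i).2 fun v hv w' hw' => ?_,
    (homologyMap_surjective_iff f i).2 fun w hw => ?_⟩
  · obtain ⟨v', rfl⟩ := (h (i + 1)).2 w'
    rw [hom_d_apply] at hw'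
    exact ⟨v', (h i).1 hw'⟩
  · obtain ⟨v, rfl⟩ := (h i).2 w
    refine ⟨v, fun j => (h j).1 ?_, 0, by simp⟩
    rw [← hom_d_apply, hw j, map_zero]

/-- A degreewise surjective chain map with acyclic kernel is a weak equivalence. -/
theorem quasiIso_of_surjective {V W : Ch R} (f : V ⟶ W)
    (hs : ∀ i, Function.Surjective (f.f i).hom)
    (hk : ∀ i x, IsCycle V i x → (f.f i).hom x = 0 →
      ∃ y, (f.f (i + 1)).hom y = 0 ∧ (V.d (i + 1) i).hom y = x) : QuasiIso f := by
  rw [quasiIso_iff_bijective]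
  refine fun i => ⟨(homologyMap_injective_iff f i).2 fun v hv w' hw' => ?_,
    (homologyMap_surjective_iff f i).2 fun w hw => ?_⟩
  · obtain ⟨v', rfl⟩ := hs _ w'
    rw [hom_d_apply] at hw'
    obtain ⟨y, -, hy⟩ := hk i (v - (V.d (i + 1) i).hom v')
      (fun j => by rw [map_sub, hv j, d_d_apply, sub_zero]) (by rw [map_sub, hw', sub_self])
    exact ⟨v' + y, by rw [map_add, hy]; abel⟩
  · obtain ⟨v, rfl⟩ := hs _ w
    rcases i with _ | i
    · exact ⟨v, isCycle_zero _ _, 0, by simp⟩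
    · obtain ⟨y, hy, hy'⟩ := hk i ((V.d (i + 1) i).hom v) (isCycle_d _ _ _)
        (by rw [← hom_d_apply, hw i])
      exact ⟨v - y, isCycle_succ (by rw [map_sub, hy', sub_self]), 0, by simp [hy]⟩

/-- A degreewise injective chain map with acyclic cokernel is a weak equivalence. -/
theorem quasiIso_of_injective {V W : Ch R} (f : V ⟶ W)
    (hi : ∀ i, Function.Injective (f.f i).hom)
    (hk : ∀ i w, (∀ j, ∃ v, (f.f j).hom v = (W.d i j).hom w) →
      ∃ w' v, w = (f.f i).hom v + (W.d (i + 1) i).hom w') : QuasiIso f := by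
  rw [quasiIso_iff_bijective]
  refine fun i => ⟨(homologyMap_injective_iff f i).2 fun v hv w' hw' => ?_,
    (homologyMap_surjective_iff f i).2 fun w hw => ?_⟩
  · obtain ⟨w₂, v', hv'⟩ := hk (i + 1) w' (fun j => by
      by_cases hj : j = i
      · subst hj; exact ⟨v, hw'.symm⟩
      · exact ⟨0, by rw [W.shape (i + 1) j (by simp; omega), map_zero]; rfl⟩)
    refine ⟨v', hi i ?_⟩
    rw [← hw', hv', map_add, d_d_apply, add_zero, hom_d_apply]
  · obtain ⟨w', v, rfl⟩ := hk i w fun j => ⟨0, by rw [hw j, map_zero]⟩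
    refine ⟨v, fun j => hi j ?_, w', rfl⟩
    have := hw j
    rw [map_add, d_d_apply, add_zero] at this
    rw [← hom_d_apply, this, map_zero]

/-! ### Products, subcomplexes and coproducts -/

/-- The direct product of two complexes. -/
def prodC (V W : Ch R) : Ch R where
  X i := ModuleCat.of R (V.X i × W.X i)
  d i j := ModuleCat.ofHom ((V.d i j).hom.prodMap (W.d i j).hom)
  shape i j h := by
    rw [V.shape i j h, W.shape i j h]; rfl
  d_comp_d' i j k _ _ := by
    refine ModuleCat.hom_ext (LinearMap.ext fun x => ?_)
    exact Prod.ext (d_d_apply V i j k x.1) (d_d_apply W i j k x.2)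

/-- The subcomplex given by submodules that the differential respects. -/
def subC (V : Ch R) (N : ∀ i, Submodule R (V.X i))
    (h : ∀ i, ∀ x ∈ N (i + 1), (V.d (i + 1) i).hom x ∈ N i) : Ch R where
  X i := ModuleCat.of R (N i)
  d i j := ModuleCat.ofHom ((V.d i j).hom.restrict (p := N i) (q := N j) (by
    intro x hx
    by_cases hj : j + 1 = i
    · subst hj; exact h j x hx
    · rw [V.shape i j hj]; exact zero_mem _))
  shape i j h := by
    refine ModuleCat.hom_ext (LinearMap.ext fun x => Subtype.ext ?_)
    change (V.d i j).hom x.1 = 0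
    rw [V.shape i j h]; rfl
  d_comp_d' i j k _ _ := by
    refine ModuleCat.hom_ext (LinearMap.ext fun x => ?_)
    exact Subtype.ext (d_d_apply V i j k x.1)

/-- The inclusion of a subcomplex. -/
def subι (V : Ch R) (N : ∀ i, Submodule R (V.X i)) (h) : subC V N h ⟶ V :=
  homMk (V := subC V N h) (fun i => (N i).subtype) (fun _ _ => rfl)

theorem comp_f_apply {U V W : Ch R} (f : U ⟶ V) (g : V ⟶ W) (i : ℕ) (x : U.X i) :
    ((f ≫ g).f i).hom x = (g.f i).hom ((f.f i).hom x) := rfl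

theorem hom_ext_apply {V W : Ch R} {f g : V ⟶ W} (h : ∀ i x, (f.f i).hom x = (g.f i).hom x) :
    f = g :=
  HomologicalComplex.hom_ext _ _ fun i => ModuleCat.hom_ext (LinearMap.ext (h i))

/-- A cofan of complexes that is degreewise a direct sum is a coproduct. -/
theorem nonempty_isColimit_cofan {J : Type*} [DecidableEq J] {W : J → Ch R} {T : Ch R}
    (ι : ∀ j, W j ⟶ T)
    (h : ∀ i, Function.Bijective
      (DirectSum.toModule R J (T.X i) (fun j => ((ι j).f i).hom))) :
    Nonempty (IsColimit (Cofan.mk T ι)) := by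
  refine ⟨HomologicalComplex.isColimitOfEval _ _ fun i => ?_⟩
  refine (isColimitMapCoconeCofanMkEquiv (HomologicalComplex.eval _ _ i) W ι).symm ?_
  let e := LinearEquiv.ofBijective _ (h i)
  have he (j) (x : (W j).X i) : e.symm (((ι j).f i).hom x) = DirectSum.lof R J _ j x := by
    rw [LinearEquiv.symm_apply_eq]
    simp [e]
  refine Cofan.IsColimit.mk _
    (fun s => ModuleCat.ofHom ((DirectSum.toModule R J s.pt (fun j => (s.inj j).hom)) ∘ₗ
      e.symm.toLinearMap)) (fun s j => ?_) (fun s m hm => ?_)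
  · refine ModuleCat.hom_ext (LinearMap.ext fun x => ?_)
    exact (congrArg (DirectSum.toModule R J s.pt (fun j => (s.inj j).hom)) (he j x)).trans
      (DirectSum.toModule_lof (M := fun j => (W j).X i) R j x)
  · refine ModuleCat.hom_ext (LinearMap.ext fun x => ?_)
    obtain ⟨x, rfl⟩ := e.surjective x
    refine Eq.trans ?_ (congrArg (DirectSum.toModule R J s.pt (fun j => (s.inj j).hom))
      (e.symm_apply_apply x).symm)
    refine LinearMap.congr_fun (f := m.hom.comp e.toLinearMap)
      (g := DirectSum.toModule R J s.pt (fun j => (s.inj j).hom)) ?_ x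
    refine DirectSum.linearMap_ext _ fun j => LinearMap.ext fun y => ?_
    refine Eq.trans ?_ (DirectSum.toModule_lof (M := fun j => (W j).X i)
      (φ := fun j => (s.inj j).hom) R j y).symm
    refine Eq.trans ?_ (congrArg (fun f => f.hom y) (hm j))
    exact congrArg m.hom (DirectSum.toModule_lof (M := fun j => (W j).X i)
      (φ := fun j => ((ι j).f i).hom) R j y)

/-- The terms of a coproduct are generated by the images of the inclusions. -/
theorem iSup_range_ι_eq_top {J : Type u} (W : J → Ch R) (i : ℕ) :
    ⨆ j, LinearMap.range ((Sigma.ι W j).f i).hom = ⊤ := by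
  set N := ⨆ j, LinearMap.range ((Sigma.ι W j).f i).hom with hN
  have hc : IsColimit (Cofan.mk ((∐ W).X i) fun j => (Sigma.ι W j).f i) :=
    isColimitCofanMkObjOfIsColimit (HomologicalComplex.eval _ _ i) W _ (coproductIsCoproduct W)
  -- The quotient by the span of the images vanishes on every summand, hence is zero by the
  -- universal property.
  have : ModuleCat.ofHom N.mkQ = 0 := by
    refine Cofan.IsColimit.hom_ext hc _ _ fun j => ?_
    refine ModuleCat.hom_ext (LinearMap.ext fun x => ?_)
    change N.mkQ (((Sigma.ι W j).f i).hom x) = 0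
    rw [Submodule.mkQ_apply, Submodule.Quotient.mk_eq_zero]
    exact Submodule.mem_iSup_of_mem j ⟨x, rfl⟩
  rw [← Submodule.ker_mkQ N]
  exact LinearMap.ker_eq_top.2 (congrArg ModuleCat.Hom.hom this)

/-! ### First closure properties of cellular complexes -/

namespace IsCellular
variable {A : Ch R}

theorem of_shortExact {U V W : Ch R} (f : U ⟶ V) (g : V ⟶ W)
    (hf : ∀ i, Function.Injective (f.f i).hom)
    (hg : ∀ i, Function.Surjective (g.f i).hom)
    (hfg : ∀ i, Function.Exact (f.f i).hom (g.f i).hom)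
    (hU : IsCellular A U) (hV : IsCellular A V) : IsCellular A W := by
  let S : ShortComplex (Ch R) := ShortComplex.mk f g
    (hom_ext_apply fun i x => (hfg i).apply_apply_eq_zero x)
  refine quotient S (HomologicalComplex.shortExact_of_degreewise_shortExact S fun i => ?_) hU hV
  exact ModuleCat.shortComplex_shortExact (S.map (HomologicalComplex.eval _ _ i)) (hfg i) (hf i)
    (hg i)

theorem of_directSum {J : Type u} [DecidableEq J] {W : J → Ch R} {T : Ch R}
    (ι : ∀ j, W j ⟶ T)
    (h : ∀ i, Function.Bijective
      (DirectSum.toModule R J (T.X i) (fun j => ((ι j).f i).hom)))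
    (hW : ∀ j, IsCellular A (W j)) : IsCellular A T := by
  obtain ⟨hc⟩ := nonempty_isColimit_cofan ι h
  exact weakEquiv_target ((coproductIsCoproduct W).coconePointUniqueUpToIso hc).hom
    inferInstance (sum J W hW)

theorem of_directSum_nat {W : ℕ → Ch R} {T : Ch R} (ι : ∀ j, W j ⟶ T)
    (h : ∀ i, Function.Bijective
      (DirectSum.toModule R ℕ (T.X i) (fun j => ((ι j).f i).hom)))
    (hW : ∀ j, IsCellular A (W j)) : IsCellular A T := by
  obtain ⟨hc⟩ := nonempty_isColimit_cofan ι h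
  have e := Sigma.reindex Equiv.ulift.{u} W
  exact weakEquiv_target (e ≪≫ (coproductIsCoproduct W).coconePointUniqueUpToIso hc).hom
    inferInstance (sum _ _ fun j => hW j.down)

/-- The empty direct sum is the zero complex, and it is weakly equivalent to `T`. -/
theorem of_isAcyclic {T : Ch R} (h : IsAcyclic T) : IsCellular A T := by
  let W : PEmpty.{u + 1} → Ch R := fun j => j.elim
  have h0 (i) (x : (∐ W).X i) : x = 0 := by
    have : 𝟙 (∐ W) = 0 := Sigma.hom_ext _ _ fun j => j.elim
    exact congrArg (fun f : ∐ W ⟶ ∐ W => (f.f i).hom x) this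
  refine weakEquiv_target (0 : ∐ W ⟶ T) (quasiIso_of_injective _ (fun i x y _ => ?_)
    (fun i w hw => ?_)) (sum _ W fun j => j.elim)
  · rw [h0 i x, h0 i y]
  · obtain ⟨y, rfl⟩ := h i w fun j => by
      obtain ⟨v, hv⟩ := hw j
      exact hv.symm
    exact ⟨y, 0, by simp⟩

theorem prod {V W : Ch R} (hV : IsCellular A V) (hW : IsCellular A W) :
    IsCellular A (prodC V W) := by
  let F : ULift.{u} Bool → Ch R := fun b => match b.down with | true => V | false => W
  let il : V ⟶ prodC V W :=
    homMk (W := prodC V W) (fun i => LinearMap.inl R (V.X i) (W.X i)) fun i x =>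
      Prod.ext rfl (map_zero (W.d (i + 1) i).hom)
  let ir : W ⟶ prodC V W :=
    homMk (W := prodC V W) (fun i => LinearMap.inr R (V.X i) (W.X i)) fun i x =>
      Prod.ext (map_zero (V.d (i + 1) i).hom) rfl
  let ι : ∀ b, F b ⟶ prodC V W := fun b => match b with | ⟨true⟩ => il | ⟨false⟩ => ir
  have hc : IsColimit (Cofan.mk (prodC V W) ι) := by
    refine Cofan.IsColimit.mk _ (fun s => homMk (V := prodC V W)
      (fun i => LinearMap.coprod ((s.inj ⟨true⟩).f i).hom ((s.inj ⟨false⟩).f i).hom) ?_) ?_ ?_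
    · rintro i ⟨x, y⟩
      change _ = ((s.inj ⟨true⟩).f i).hom ((V.d (i + 1) i).hom x) +
        ((s.inj ⟨false⟩).f i).hom ((W.d (i + 1) i).hom y)
      rw [← hom_d_apply, ← hom_d_apply, ← map_add]
      rfl
    · rintro s ⟨_ | _⟩
      · refine hom_ext_apply fun i x => ?_
        change ((s.inj ⟨true⟩).f i).hom 0 + ((s.inj ⟨false⟩).f i).hom x = _
        rw [map_zero, zero_add]
      · refine hom_ext_apply fun i x => ?_
        change ((s.inj ⟨true⟩).f i).hom x + ((s.inj ⟨false⟩).f i).hom 0 = _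
        rw [map_zero, add_zero]
    · intro s m hm
      refine hom_ext_apply fun i x => ?_
      obtain ⟨x, y⟩ := x
      change _ = ((s.inj ⟨true⟩).f i).hom x + ((s.inj ⟨false⟩).f i).hom y
      rw [← hm ⟨true⟩, ← hm ⟨false⟩]
      refine Eq.trans (congrArg (m.f i).hom ?_) (map_add (m.f i).hom ((x, 0) : V.X i × W.X i)
        ((0, y) : V.X i × W.X i))
      exact Prod.ext (add_zero x).symm (zero_add y).symm
  refine weakEquiv_target ((coproductIsCoproduct F).coconePointUniqueUpToIso hc).hom
    inferInstance (sum _ F ?_)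
  rintro ⟨_ | _⟩
  exacts [hW, hV]

end IsCellular

/-! ### Sequential colimits, retracts and extensions -/

/-- The direct sum of a sequence of complexes. -/
noncomputable def directSumC (W : ℕ → Ch R) : Ch R where
  X i := ModuleCat.of R (DirectSum ℕ fun j => (W j).X i)
  d i k := ModuleCat.ofHom (DirectSum.lmap fun j => ((W j).d i k).hom)
  shape i k h := by
    refine ModuleCat.hom_ext (DirectSum.linearMap_ext _ fun j => LinearMap.ext fun x => ?_)
    refine (DirectSum.lmap_lof (fun j => ((W j).d i k).hom) j x).trans ?_
    rw [(W j).shape i k h]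
    exact map_zero (DirectSum.lof R ℕ (fun j => (W j).X k) j)
  d_comp_d' i k l _ _ := by
    refine ModuleCat.hom_ext (DirectSum.linearMap_ext _ fun j => LinearMap.ext fun x => ?_)
    refine (congrArg (DirectSum.lmap fun j => ((W j).d k l).hom)
      (DirectSum.lmap_lof (fun j => ((W j).d i k).hom) j x)).trans ?_
    refine (DirectSum.lmap_lof (fun j => ((W j).d k l).hom) j _).trans ?_
    rw [d_d_apply]
    exact map_zero (DirectSum.lof R ℕ (fun j => (W j).X l) j)

/-- The inclusion of a summand of a direct sum. -/
noncomputable def directSumι (W : ℕ → Ch R) (j : ℕ) : W j ⟶ directSumC W :=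
  homMk (W := directSumC W) (fun i => DirectSum.lof R ℕ (fun j => (W j).X i) j)
    fun i x => DirectSum.lmap_lof (fun j => ((W j).d (i + 1) i).hom) j x

/-- The projection of a direct sum onto a summand. -/
noncomputable def directSumπ (W : ℕ → Ch R) (i j : ℕ) : (directSumC W).X i →ₗ[R] (W j).X i :=
  DirectSum.component R ℕ (fun j => (W j).X i) j

theorem directSumπ_ι_self (W : ℕ → Ch R) (i j : ℕ) (x : (W j).X i) :
    directSumπ W i j (((directSumι W j).f i).hom x) = x :=
  DirectSum.component.lof_self (M := fun j => (W j).X i) R j x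

theorem directSumπ_ι_ne (W : ℕ → Ch R) (i : ℕ) {j k : ℕ} (h : j ≠ k) (x : (W j).X i) :
    directSumπ W i k (((directSumι W j).f i).hom x) = 0 :=
  (DirectSum.component.of (M := fun j => (W j).X i) R k j x).trans (dif_neg h)

theorem directSumC_hom_ext {W : ℕ → Ch R} {i : ℕ} {M : Type*} [AddCommGroup M] [Module R M]
    {f g : (directSumC W).X i →ₗ[R] M}
    (h : ∀ j x, f (((directSumι W j).f i).hom x) = g (((directSumι W j).f i).hom x)) : f = g :=
  DirectSum.linearMap_ext _ fun j => LinearMap.ext fun x => h j x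

theorem directSumC_ext {W : ℕ → Ch R} {i : ℕ} {x y : (directSumC W).X i}
    (h : ∀ j, directSumπ W i j x = directSumπ W i j y) : x = y :=
  DFinsupp.ext h

theorem directSumC_induction {W : ℕ → Ch R} {i : ℕ} {P : (directSumC W).X i → Prop}
    (h0 : P 0) (hι : ∀ j x, P (((directSumι W j).f i).hom x))
    (ha : ∀ x y, P x → P y → P (x + y)) (x : (directSumC W).X i) : P x :=
  DirectSum.induction_on (motive := P) x h0 hι ha

theorem directSumC_hom_apply_eq {W : ℕ → Ch R} {i : ℕ} {M : Type*} [AddCommGroup M] [Module R M]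
    (f g : (directSumC W).X i →ₗ[R] M)
    (h : ∀ j x, f (((directSumι W j).f i).hom x) = g (((directSumι W j).f i).hom x)) (x) :
    f x = g x := by
  rw [directSumC_hom_ext h]

/-- The chain map out of a direct sum with given components. -/
noncomputable def directSumDesc {W : ℕ → Ch R} {T : Ch R} (f : ∀ j, W j ⟶ T) :
    directSumC W ⟶ T :=
  homMk (V := directSumC W) (fun i => DirectSum.toModule R ℕ (T.X i) fun j => ((f j).f i).hom)
    fun i x => by
      let g (i) : (directSumC W).X i →ₗ[R] T.X i :=
        DirectSum.toModule R ℕ (T.X i) fun j => ((f j).f i).hom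
      have hg (i j) (x : (W j).X i) : g i (((directSumι W j).f i).hom x) = ((f j).f i).hom x :=
        DirectSum.toModule_lof (M := fun j => (W j).X i) R j x
      refine directSumC_hom_apply_eq ((T.d (i + 1) i).hom ∘ₗ g (i + 1))
        (g i ∘ₗ ((directSumC W).d (i + 1) i).hom) (fun j x => ?_) x
      rw [LinearMap.comp_apply, LinearMap.comp_apply, hom_d_apply, hg, hg, hom_d_apply]

theorem directSumDesc_ι {W : ℕ → Ch R} {T : Ch R} (f : ∀ j, W j ⟶ T) (i j : ℕ)
    (x : (W j).X i) :
    ((directSumDesc f).f i).hom (((directSumι W j).f i).hom x) = ((f j).f i).hom x :=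
  DirectSum.toModule_lof (M := fun j => (W j).X i) R j x

theorem IsCellular.directSumC {A : Ch R} {W : ℕ → Ch R} (hW : ∀ j, IsCellular A (W j)) :
    IsCellular A (directSumC W) := by
  refine of_directSum_nat (directSumι W) (fun i => ?_) hW
  have : (DirectSum.toModule R ℕ ((CellularComplexes.directSumC W).X i)
      fun j => ((directSumι W j).f i).hom) = LinearMap.id := by
    refine DirectSum.linearMap_ext _ fun j => LinearMap.ext fun x => ?_
    exact DirectSum.toModule_lof (M := fun j => (W j).X i)
      (φ := fun j => ((directSumι W j).f i).hom) R j x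
  rw [this]
  exact Function.bijective_id

/-- The colimit of a sequence of cellular complexes is cellular. -/
theorem IsCellular.telescope {A : Ch R} {W : ℕ → Ch R} {L : Ch R} (t : ∀ j, W j ⟶ W (j + 1))
    (c : ∀ j, W j ⟶ L) (htc : ∀ j, t j ≫ c (j + 1) = c j)
    (hinj : ∀ j i x, ((c j).f i).hom x = 0 → ((t j).f i).hom x = 0)
    (hsurj : ∀ i y, ∃ j x, ((c j).f i).hom x = y)
    (hW : ∀ j, IsCellular A (W j)) : IsCellular A L := by
  -- The identity minus the shift along `t`: it is injective with cokernel `L`, so `L` is a quotient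
  -- of two cellular complexes.
  let α : CellularComplexes.directSumC W ⟶ CellularComplexes.directSumC W :=
    directSumDesc fun j => directSumι W j - t j ≫ directSumι W (j + 1)
  have hα (i j) (x : (W j).X i) : (α.f i).hom (((directSumι W j).f i).hom x) =
      ((directSumι W j).f i).hom x -
        ((directSumι W (j + 1)).f i).hom (((t j).f i).hom x) :=
    directSumDesc_ι ..
  have htc' (i j) (x : (W j).X i) :
      ((c (j + 1)).f i).hom (((t j).f i).hom x) = ((c j).f i).hom x := by
    rw [← comp_f_apply, htc]
  have hαγ (i) (x : (CellularComplexes.directSumC W).X i) :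
      ((directSumDesc c).f i).hom ((α.f i).hom x) = 0 := by
    refine directSumC_hom_apply_eq (((directSumDesc c).f i).hom ∘ₗ (α.f i).hom) 0
      (fun j x => ?_) x
    rw [LinearMap.comp_apply, hα, map_sub, directSumDesc_ι, directSumDesc_ι, htc', sub_self]
    rfl
  -- Modulo the image of `α`, every element can be moved into a single summand, arbitrarily far out.
  have hpush (i) (x : (CellularComplexes.directSumC W).X i) : ∃ N, ∀ M ≥ N, ∃ w : (W M).X i,
      ∃ y, (α.f i).hom y = x - ((directSumι W M).f i).hom w := by
    induction x using directSumC_induction with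
    | h0 => exact ⟨0, fun M _ => ⟨0, 0, by simp⟩⟩
    | hι j x =>
      refine ⟨j, fun M hM => ?_⟩
      induction M, hM using Nat.le_induction with
      | base => exact ⟨x, 0, by rw [map_zero, sub_self]⟩
      | succ M _ ih =>
        obtain ⟨w, y, hy⟩ := ih
        refine ⟨((t M).f i).hom w, y + ((directSumι W M).f i).hom w, ?_⟩
        rw [map_add, hy, hα, sub_add_sub_cancel]
    | ha x x' h h' =>
      obtain ⟨N, hN⟩ := h
      obtain ⟨N', hN'⟩ := h'
      refine ⟨max N N', fun M hM => ?_⟩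
      obtain ⟨w, y, hy⟩ := hN M (le_trans (le_max_left _ _) hM)
      obtain ⟨w', y', hy'⟩ := hN' M (le_trans (le_max_right _ _) hM)
      exact ⟨w + w', y + y', by rw [map_add, map_add, hy, hy']; abel⟩
  refine of_shortExact α (directSumDesc c) (fun i => ?_) (fun i y => ?_) (fun i x => ⟨?_, ?_⟩)
    (.directSumC hW) (.directSumC hW)
  · rw [injective_iff_map_eq_zero]
    intro x hx
    have hz : directSumπ W i 0 ((α.f i).hom x) = directSumπ W i 0 x := by
      refine directSumC_hom_apply_eq (directSumπ W i 0 ∘ₗ (α.f i).hom) (directSumπ W i 0)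
        (fun j x => ?_) x
      rw [LinearMap.comp_apply, hα, map_sub, directSumπ_ι_ne W i (j.succ_ne_zero), sub_zero]
    have hs (k) : directSumπ W i (k + 1) ((α.f i).hom x) =
        directSumπ W i (k + 1) x - ((t k).f i).hom (directSumπ W i k x) := by
      refine directSumC_hom_apply_eq (directSumπ W i (k + 1) ∘ₗ (α.f i).hom)
        (directSumπ W i (k + 1) - ((t k).f i).hom ∘ₗ directSumπ W i k) (fun j x => ?_) x
      rw [LinearMap.comp_apply, hα, map_sub, LinearMap.sub_apply, LinearMap.comp_apply]
      congr 1
      by_cases hj : j = k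
      · subst hj
        rw [directSumπ_ι_self, directSumπ_ι_self]
      · rw [directSumπ_ι_ne W i (by omega), directSumπ_ι_ne W i hj, map_zero]
    -- The component at `k + 1` of an element of the kernel is determined by the one at `k`, and the
    -- component at `0` vanishes.
    refine directSumC_ext fun k => ?_
    induction k with
    | zero => rw [← hz, hx]
    | succ k ih =>
      have := hs k
      rw [hx, ih, map_zero, map_zero, map_zero, sub_zero] at this
      rw [← this, map_zero]
  · obtain ⟨j, x, rfl⟩ := hsurj i y
    exact ⟨_, directSumDesc_ι c i j x⟩
  · intro hx
    obtain ⟨N, hN⟩ := hpush i x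
    obtain ⟨w, y, hy⟩ := hN N le_rfl
    have hw : ((c N).f i).hom w = 0 := by
      have := congrArg ((directSumDesc c).f i).hom hy
      rw [hαγ, map_sub, hx, directSumDesc_ι, zero_sub, eq_comm, neg_eq_zero] at this
      exact this
    refine ⟨y + ((directSumι W N).f i).hom w, ?_⟩
    rw [map_add, hα, hinj N i w hw, map_zero, sub_zero, hy, sub_add_cancel]
  · rintro ⟨y, rfl⟩
    exact hαγ i y

/-- A retract of a cellular complex is cellular. -/
theorem IsCellular.retract {A V W : Ch R} (s : V ⟶ W) (r : W ⟶ V) (h : s ≫ r = 𝟙 V)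
    (hW : IsCellular A W) : IsCellular A V := by
  -- `V` is the colimit of `W → W → ⋯` along the idempotent `r ≫ s`.
  refine telescope (W := fun _ => W) (fun _ => r ≫ s) (fun _ => r) (fun _ => by simp [h])
    (fun j i x hx => ?_) (fun i y => ⟨0, (s.f i).hom y, ?_⟩) (fun _ => hW)
  · rw [comp_f_apply, hx, map_zero]
  · rw [← comp_f_apply, h]; rfl

/-- If `0 ⟶ U ⟶ V ⟶ W ⟶ 0` and `0 ⟶ W' ⟶ B ⟶ W ⟶ 0` are exact with `B` acyclic and
`U`, `W'` cellular, then `V` is cellular. -/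
theorem IsCellular.extension {A U V W W' B : Ch R} (f : U ⟶ V) (g : V ⟶ W) (f' : W' ⟶ B)
    (g' : B ⟶ W)
    (hf : ∀ i, Function.Injective (f.f i).hom) (hg : ∀ i, Function.Surjective (g.f i).hom)
    (hfg : ∀ i, Function.Exact (f.f i).hom (g.f i).hom)
    (hf' : ∀ i, Function.Injective (f'.f i).hom) (hg' : ∀ i, Function.Surjective (g'.f i).hom)
    (hfg' : ∀ i, Function.Exact (f'.f i).hom (g'.f i).hom) (hB : IsAcyclic B)
    (hU : IsCellular A U) (hW' : IsCellular A W') : IsCellular A V := by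
  -- The pullback `E` of `V` and `B` over `W`. It contains `U` with acyclic quotient `B`, so it is
  -- cellular, and `V` is its quotient by `W'`.
  let N : ∀ i, Submodule R ((prodC V B).X i) := fun i =>
    LinearMap.eqLocus ((g.f i).hom ∘ₗ LinearMap.fst R (V.X i) (B.X i))
      ((g'.f i).hom ∘ₗ LinearMap.snd R (V.X i) (B.X i))
  have hN (i) (x : V.X i) (b : B.X i) :
      ((x, b) : V.X i × B.X i) ∈ N i ↔ (g.f i).hom x = (g'.f i).hom b := Iff.rfl
  let E : Ch R := subC (prodC V B) N (by
    rintro i ⟨x, b⟩ h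
    exact (hom_d_apply g (i + 1) i x).symm.trans
      ((congrArg (W.d (i + 1) i).hom h).trans (hom_d_apply g' (i + 1) i b)))
  let a : U ⟶ E := homMk (W := E) (fun i => LinearMap.codRestrict (N i)
      (LinearMap.inl R (V.X i) (B.X i) ∘ₗ (f.f i).hom) fun x => by
        change (g.f i).hom _ = (g'.f i).hom 0
        rw [map_zero]; exact (hfg i).apply_apply_eq_zero x)
    fun i x => Subtype.ext (Prod.ext (hom_d_apply f _ _ x) (map_zero (B.d (i + 1) i).hom))
  let a' : W' ⟶ E := homMk (W := E) (fun i => LinearMap.codRestrict (N i)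
      (LinearMap.inr R (V.X i) (B.X i) ∘ₗ (f'.f i).hom) fun x => by
        change (g.f i).hom 0 = (g'.f i).hom _
        rw [map_zero]; exact ((hfg' i).apply_apply_eq_zero x).symm)
    fun i x => Subtype.ext (Prod.ext (map_zero (V.d (i + 1) i).hom) (hom_d_apply f' _ _ x))
  let q : E ⟶ V := homMk (V := E) (fun i => LinearMap.fst R (V.X i) (B.X i) ∘ₗ (N i).subtype)
    fun i x => rfl
  have ha : QuasiIso a := by
    refine quasiIso_of_injective a (fun i x y h => hf i ?_) (fun i w hw => ?_)
    · exact congrArg (fun z => z.1.1) h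
    · obtain ⟨⟨x, b⟩, hxb⟩ := w
      have hxb := (hN i x b).1 hxb
      obtain ⟨b', rfl⟩ := hB i b fun j => by
        obtain ⟨v, hv⟩ := hw j
        exact (congrArg (fun z => z.1.2) hv).symm
      obtain ⟨x', hx'⟩ := hg (i + 1) ((g'.f (i + 1)).hom b')
      obtain ⟨v, hv⟩ := ((hfg i) (x - (V.d (i + 1) i).hom x')).1 (by
        rw [map_sub, hxb, ← hom_d_apply, ← hom_d_apply, hx', sub_self])
      refine ⟨⟨(x', b'), hx'⟩, v, Subtype.ext (Prod.ext ?_ (zero_add _).symm)⟩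
      change x = (f.f i).hom v + (V.d (i + 1) i).hom x'
      rw [hv, sub_add_cancel]
  refine of_shortExact a' q (fun i x y h => hf' i ?_) (fun i x => ?_) (fun i w => ⟨?_, ?_⟩) hW'
    (weakEquiv_target a ha hU)
  · exact congrArg (fun z => z.1.2) h
  · obtain ⟨b, hb⟩ := hg' i ((g.f i).hom x)
    exact ⟨⟨(x, b), hb.symm⟩, rfl⟩
  · obtain ⟨⟨x, b⟩, hxb⟩ := w
    have hxb := (hN i x b).1 hxb
    intro (h : x = 0)
    subst h
    obtain ⟨v, rfl⟩ := ((hfg' i) b).1 (by rw [← hxb, map_zero])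
    exact ⟨v, rfl⟩
  · rintro ⟨v, rfl⟩
    rfl

/-! ### Restriction to a set of degrees -/

/-- A chain complex from a sequence of linear maps. -/
noncomputable def ofC (M : ℕ → ModuleCat.{u} R) (d : ∀ n, M (n + 1) →ₗ[R] M n)
    (h : ∀ n x, d n (d (n + 1) x) = 0) : Ch R :=
  ChainComplex.of M (fun n => ModuleCat.ofHom (d n)) fun n =>
    ModuleCat.hom_ext (LinearMap.ext fun x => h n x)

theorem ofC_d (M : ℕ → ModuleCat.{u} R) (d : ∀ n, M (n + 1) →ₗ[R] M n) (h) (n : ℕ)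
    (x : M (n + 1)) : ((ofC M d h).d (n + 1) n).hom x = d n x :=
  congrArg (fun f => f.hom x) (ChainComplex.of_d M (fun n => ModuleCat.ofHom (d n)) n)

section partial_module
variable (S : Prop) [Decidable S] (M : Type u) [AddCommGroup M] [Module R M]

/-- The value of a function on the proofs of `S`, extended by zero. -/
def proofEv : (PLift S → M) →ₗ[R] M :=
  if h : S then LinearMap.proj (φ := fun _ : PLift S => M) ⟨h⟩ else 0

/-- Constant functions on the proofs of `S`. -/
def proofConst : M →ₗ[R] (PLift S → M) := LinearMap.pi fun _ => LinearMap.id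

variable {S M}

theorem proofConst_ev (x : PLift S → M) : proofConst (R := R) S M (proofEv (R := R) S M x) = x := by
  refine funext fun k => ?_
  change proofEv (R := R) S M x = x k
  rw [proofEv, dif_pos k.down]
  rfl

theorem proofEv_const (h : S) (x : M) :
    proofEv (R := R) S M (proofConst (R := R) S M x) = x := by
  rw [proofEv, dif_pos h]
  rfl

theorem proofEv_neg (h : ¬ S) (x : PLift S → M) : proofEv (R := R) S M x = 0 := by
  rw [proofEv, dif_neg h]
  rfl

end partial_module

/-- The part of a complex in the degrees singled out by a predicate. -/
def restr (W : Ch R) (S : ℕ → Prop) [DecidablePred S] : Ch R where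
  -- Functions on the proofs of `S i` form `W.X i` or the zero module, with no case distinction in
  -- the type.
  X i := ModuleCat.of R (PLift (S i) → W.X i)
  d i j := ModuleCat.ofHom (proofConst (S j) (W.X j) ∘ₗ (W.d i j).hom ∘ₗ proofEv (S i) (W.X i))
  shape i j h := by
    refine ModuleCat.hom_ext (LinearMap.ext fun x => ?_)
    change proofConst (R := R) (S j) (W.X j) ((W.d i j).hom (proofEv (R := R) (S i) (W.X i) x)) = 0
    rw [W.shape i j h]
    exact map_zero (proofConst (R := R) (S j) (W.X j))
  d_comp_d' i j k _ _ := by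
    refine ModuleCat.hom_ext (LinearMap.ext fun x => ?_)
    change proofConst (R := R) (S k) (W.X k) ((W.d j k).hom (proofEv (R := R) (S j) (W.X j)
      (proofConst (R := R) (S j) (W.X j) ((W.d i j).hom (proofEv (R := R) (S i) (W.X i) x))))) = 0
    by_cases hj : S j
    · rw [proofEv_const hj, d_d_apply, map_zero]
    · rw [proofEv_neg hj, map_zero, map_zero]

section restr
variable (W : Ch R) (S : ℕ → Prop) [DecidablePred S]

/-- The value of an element of a restricted complex, extended by zero. -/
def restrEv (i : ℕ) : (restr W S).X i →ₗ[R] W.X i := proofEv (S i) (W.X i)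

/-- The projection onto the term of a restricted complex. -/
def restrMk (i : ℕ) : W.X i →ₗ[R] (restr W S).X i := proofConst (S i) (W.X i)

variable {W S}

theorem restrMk_ev {i : ℕ} (x : (restr W S).X i) : restrMk W S i (restrEv W S i x) = x :=
  proofConst_ev (R := R) (S := S i) (M := W.X i) x

theorem restrEv_mk {i : ℕ} (h : S i) (x : W.X i) : restrEv W S i (restrMk W S i x) = x :=
  proofEv_const (R := R) h x

theorem restrEv_neg {i : ℕ} (h : ¬ S i) (x : (restr W S).X i) : restrEv W S i x = 0 :=
  proofEv_neg (R := R) (S := S i) (M := W.X i) h x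

theorem restrEv_injective (i : ℕ) : Function.Injective (restrEv W S i) := fun x y h => by
  rw [← restrMk_ev x, h, restrMk_ev]

theorem restr_eq_of_neg {i : ℕ} (h : ¬ S i) (x y : (restr W S).X i) : x = y :=
  restrEv_injective i (by rw [restrEv_neg h, restrEv_neg h])

theorem restr_d (i j : ℕ) (x : (restr W S).X i) :
    ((restr W S).d i j).hom x = restrMk W S j ((W.d i j).hom (restrEv W S i x)) := rfl

/-- The map of restricted complexes induced by a chain map. -/
def restrMap {V W : Ch R} (g : V ⟶ W) (S T : ℕ → Prop) [DecidablePred S] [DecidablePred T]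
    (h : ∀ i, S (i + 1) → T i → S i ∧ T (i + 1)) : restr V S ⟶ restr W T :=
  homMk (fun i => restrMk W T i ∘ₗ (g.f i).hom ∘ₗ restrEv V S i) fun i x => by
    simp only [LinearMap.comp_apply, restr_d]
    by_cases hT : T i
    · by_cases hS : S (i + 1)
      · obtain ⟨h1, h2⟩ := h i hS hT
        rw [restrEv_mk h1, restrEv_mk h2, hom_d_apply]
      · simp [restrEv_neg hS]
    · exact restr_eq_of_neg hT _ _

theorem restrMap_apply {V W : Ch R} (g : V ⟶ W) (S T : ℕ → Prop) [DecidablePred S]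
    [DecidablePred T] (h) (i : ℕ) (x : (restr V S).X i) :
    ((restrMap g S T h).f i).hom x = restrMk W T i ((g.f i).hom (restrEv V S i x)) := rfl

variable (W S) in
/-- The inclusion of a restricted complex. -/
def restrι (h : ∀ i, S (i + 1) → S i) : restr W S ⟶ W :=
  homMk (fun i => restrEv W S i) fun i x => by
    rw [restr_d]
    by_cases hS : S (i + 1)
    · rw [restrEv_mk (h i hS)]
    · simp [restrEv_neg hS]

theorem restrι_apply (h : ∀ i, S (i + 1) → S i) (i : ℕ) (x : (restr W S).X i) :
    ((restrι W S h).f i).hom x = restrEv W S i x := rfl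

end restr

theorem id_f_apply (W : Ch R) (i : ℕ) (x : W.X i) :
    (HomologicalComplex.Hom.f (𝟙 W) i).hom x = x := rfl

namespace IsCellular
variable {A : Ch R}

/-- A complex is cellular if it is exhausted by cellular skeleta. -/
theorem of_skeleta (W : Ch R) (a : ℕ → ℕ) (ha : ∀ j, a j ≤ a (j + 1)) (ha' : ∀ i, ∃ j, i ≤ a j)
    (h : ∀ j, IsCellular A (restr W (· ≤ a j))) : IsCellular A W := by
  refine telescope (W := fun j => restr W (· ≤ a j))
    (fun j => restrMap (𝟙 W) _ _ fun i h1 _ => ⟨by omega, by have := ha j; omega⟩)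
    (fun j => restrι W _ fun i h1 => by omega) (fun j => ?_) (fun j i x hx => ?_)
    (fun i y => ?_) h
  · refine hom_ext_apply fun i x => ?_
    rw [comp_f_apply, restrι_apply, restrι_apply, restrMap_apply, id_f_apply]
    by_cases hi : i ≤ a j
    · rw [restrEv_mk (S := (· ≤ a (j + 1))) (hi.trans (ha j))]
    · rw [restrEv_neg (S := (· ≤ a j)) hi, map_zero, map_zero]
  · rw [restrι_apply] at hx
    rw [restrMap_apply, hx, map_zero, map_zero]
  · obtain ⟨j, hj⟩ := ha' i
    exact ⟨j, restrMk W _ i y, restrEv_mk (S := (· ≤ a j)) hj y⟩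

/-- Attaching a shifted cellular complex to a restricted complex. -/
theorem extension_restr {V W W' B : Ch R} {S T U : ℕ → Prop} [DecidablePred S] [DecidablePred T]
    [DecidablePred U] (hU : ∀ i, U i ↔ S i ∨ T i) (hST : ∀ i, S i → ¬ T i)
    (hS : ∀ i, S (i + 1) → ¬ T i)
    (φ : restr V T ⟶ W) (hφ : ∀ i, Function.Bijective (φ.f i).hom)
    (f' : W' ⟶ B) (g' : B ⟶ W)
    (hf' : ∀ i, Function.Injective (f'.f i).hom) (hg' : ∀ i, Function.Surjective (g'.f i).hom)
    (hfg' : ∀ i, Function.Exact (f'.f i).hom (g'.f i).hom) (hB : IsAcyclic B)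
    (h : IsCellular A (restr V S)) (hW' : IsCellular A W') : IsCellular A (restr V U) := by
  -- No differential runs from degrees in `S` to degrees in `T`, so the part in `S` is a subcomplex
  -- with quotient the part in `T`.
  refine extension
    (restrMap (𝟙 V) S U fun i h1 h2 => ⟨((hU i).1 h2).resolve_right (hS i h1), (hU _).2 (.inl h1)⟩)
    (restrMap (𝟙 V) U T (fun i h1 h2 => ⟨(hU i).2 (.inr h2),
      ((hU _).1 h1).resolve_left fun h3 => hS i h3 h2⟩) ≫ φ)
    f' g' (fun i x y hxy => ?_) (fun i y => ?_) (fun i x => ?_) hf' hg' hfg' hB h hW'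
  · simp only [restrMap_apply, id_f_apply] at hxy
    by_cases hi : S i
    · have := congrArg (restrEv V U i) hxy
      rw [restrEv_mk ((hU i).2 (.inl hi)), restrEv_mk ((hU i).2 (.inl hi))] at this
      exact restrEv_injective i this
    · exact restr_eq_of_neg hi _ _
  · obtain ⟨x, rfl⟩ := (hφ i).2 y
    refine ⟨restrMk V U i (restrEv V T i x), ?_⟩
    rw [comp_f_apply, restrMap_apply, id_f_apply]
    by_cases hi : T i
    · rw [restrEv_mk ((hU i).2 (.inr hi)), restrMk_ev]
    · rw [restr_eq_of_neg hi x 0, map_zero, map_zero, map_zero, map_zero]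
  · rw [comp_f_apply, map_eq_zero_iff _ (hφ i).1, restrMap_apply, id_f_apply]
    constructor
    · intro hx
      refine ⟨restrMk V S i (restrEv V U i x), restrEv_injective i ?_⟩
      rw [restrMap_apply, id_f_apply]
      by_cases hi : S i
      · rw [restrEv_mk hi, restrMk_ev]
      · by_cases hi' : T i
        · have := congrArg (restrEv V T i) hx
          rw [restrEv_mk hi'] at this
          rw [this]
          simp
        · rw [restrEv_neg (mt (hU i).1 (by tauto)), restrEv_neg (mt (hU i).1 (by tauto))]
    · rintro ⟨y, rfl⟩
      by_cases hi : T i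
      · rw [restr_eq_of_neg (fun h => hST i h hi) y 0]
        simp
      · exact restr_eq_of_neg hi _ _

end IsCellular

/-! ### Segments and their suspensions -/

/-- The complex with the module `M` in every degree and multiplication by `p` as differential. -/
noncomputable def constC (M : Type u) [AddCommGroup M] [Module R M] (p : R) (hp : p * p = 0) :
    Ch R :=
  ofC (fun _ => ModuleCat.of R M) (fun _ => LinearMap.lsmul R M p) fun _ x => by
    simp [← mul_smul, hp]

section seg
variable (M : Type u) [AddCommGroup M] [Module R M] (p : R) (hp : p * p = 0)
  (S : ℕ → Prop) [DecidablePred S]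

theorem constC_d (i : ℕ) (x : (constC M p hp).X (i + 1)) :
    ((constC M p hp).d (i + 1) i).hom x = (show M from p • (show M from x)) :=
  ofC_d _ _ _ i x

/-- The complex with the module `M` in the degrees in `S` and multiplication by `p` as
differential. -/
noncomputable abbrev seg : Ch R := restr (constC M p hp) S

/-- The value of an element of `seg`, extended by zero. -/
noncomputable def segEv (i : ℕ) : (seg M p hp S).X i →ₗ[R] M := restrEv (constC M p hp) S i

/-- The projection onto a term of `seg`. -/
noncomputable def segMk (i : ℕ) : M →ₗ[R] (seg M p hp S).X i := restrMk (constC M p hp) S i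

variable {M p hp S}

theorem segMk_ev {i : ℕ} (x : (seg M p hp S).X i) : segMk M p hp S i (segEv M p hp S i x) = x :=
  restrMk_ev x

theorem segEv_mk {i : ℕ} (h : S i) (x : M) : segEv M p hp S i (segMk M p hp S i x) = x :=
  restrEv_mk (W := constC M p hp) h x

theorem segEv_neg {i : ℕ} (h : ¬ S i) (x : (seg M p hp S).X i) : segEv M p hp S i x = 0 :=
  restrEv_neg h x

theorem segEv_injective (i : ℕ) : Function.Injective (segEv M p hp S i) := restrEv_injective i

theorem segMk_surjective (i : ℕ) : Function.Surjective (segMk M p hp S i) :=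
  fun x => ⟨_, segMk_ev x⟩

theorem seg_eq_of_neg {i : ℕ} (h : ¬ S i) (x y : (seg M p hp S).X i) : x = y :=
  restr_eq_of_neg h x y

theorem seg_d (i : ℕ) (x : (seg M p hp S).X (i + 1)) :
    ((seg M p hp S).d (i + 1) i).hom x = segMk M p hp S i (p • segEv M p hp S (i + 1) x) := by
  rw [restr_d]
  exact congrArg (segMk M p hp S i) (constC_d M p hp i _)

/-- The map of segments induced by a linear map. -/
noncomputable def segMap {N : Type u} [AddCommGroup N] [Module R N] (g : M →ₗ[R] N) :
    seg M p hp S ⟶ seg N p hp S :=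
  restrMap (homMk (V := constC M p hp) (W := constC N p hp) (fun _ => g) fun i x => by
    rw [constC_d, constC_d]
    exact (map_smul g p _).symm) S S fun _ h1 h2 => ⟨h2, h1⟩

theorem segMap_apply {N : Type u} [AddCommGroup N] [Module R N] (g : M →ₗ[R] N) (i : ℕ)
    (x : (seg M p hp S).X i) :
    ((segMap g).f i).hom x = segMk N p hp S i (g (segEv M p hp S i x)) := rfl

theorem segMap_mk {N : Type u} [AddCommGroup N] [Module R N] (g : M →ₗ[R] N) (i : ℕ) (x : M) :
    ((segMap g).f i).hom (segMk M p hp S i x) = segMk N p hp S i (g x) := by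
  by_cases h : S i
  · rw [segMap_apply, segEv_mk h]
  · exact seg_eq_of_neg h _ _

theorem segEv_segMap {N : Type u} [AddCommGroup N] [Module R N] (g : M →ₗ[R] N) (i : ℕ)
    (x : (seg M p hp S).X i) :
    segEv N p hp S i (((segMap g).f i).hom x) = g (segEv M p hp S i x) := by
  by_cases h : S i
  · rw [segMap_apply, segEv_mk h]
  · rw [segEv_neg h, segEv_neg h, map_zero]

end seg

namespace IsCellular
variable {A : Ch R} {M : Type u} [AddCommGroup M] [Module R M] {p : R} {hp : p * p = 0}
  {S T : ℕ → Prop} [DecidablePred S] [DecidablePred T]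

theorem seg_of_linearEquiv {N : Type u} [AddCommGroup N] [Module R N] (e : M ≃ₗ[R] N)
    (h : IsCellular A (seg M p hp S)) : IsCellular A (seg N p hp S) := by
  refine weakEquiv_target (segMap e.toLinearMap)
    (quasiIso_of_bijective _ fun i => ⟨fun x y hxy => ?_, fun y => ?_⟩) h
  · refine segEv_injective i (e.injective ?_)
    rw [← e.coe_toLinearMap, ← segEv_segMap, hxy, segEv_segMap]
  · obtain ⟨y, rfl⟩ := segMk_surjective i y
    refine ⟨segMk M p hp S i (e.symm y), ?_⟩
    rw [segMap_mk, e.coe_toLinearMap, e.apply_symm_apply]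

open Classical in
theorem seg_finsupp (B : Type u) (h : IsCellular A (seg R p hp S)) :
    IsCellular A (seg (B →₀ R) p hp S) := by
  refine of_directSum (J := B) (W := fun _ => seg R p hp S) (fun b => segMap (Finsupp.lsingle b))
    (fun i => ?_) (fun _ => h)
  let τ := DirectSum.toModule R B ((seg (B →₀ R) p hp S).X i)
    (fun b => ((segMap (p := p) (hp := hp) (S := S) (Finsupp.lsingle (M := R) (R := R) b)).f i).hom)
  change Function.Bijective τ
  have hτ (b) (x : (seg R p hp S).X i) : τ (DirectSum.lof R B (fun _ => (seg R p hp S).X i) b x) =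
      ((segMap (Finsupp.lsingle b)).f i).hom x :=
    DirectSum.toModule_lof (M := fun _ => (seg R p hp S).X i) R b x
  refine ⟨?_, fun y => ?_⟩
  · rw [injective_iff_map_eq_zero]
    intro x hx
    refine DFinsupp.ext fun b => segEv_injective i ?_
    -- The coordinate at `b` of the image recovers the summand at `b`, which gives injectivity.
    have key : Finsupp.lapply b ∘ₗ segEv (B →₀ R) p hp S i ∘ₗ τ =
        segEv R p hp S i ∘ₗ DirectSum.component R B (fun _ => (seg R p hp S).X i) b := by
      refine DirectSum.linearMap_ext _ fun c => LinearMap.ext fun x => ?_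
      simp only [LinearMap.comp_apply]
      rw [hτ, segEv_segMap]
      by_cases hc : c = b
      · subst hc
        rw [DirectSum.component.lof_self]
        simp
      · rw [DirectSum.component.of, dif_neg hc, map_zero]
        simp [hc]
    have := LinearMap.congr_fun key x
    simp only [LinearMap.comp_apply] at this
    rw [hx, map_zero, map_zero] at this
    refine this.symm.trans ?_
    exact (map_zero _).symm
  · obtain ⟨v, rfl⟩ := segMk_surjective i y
    induction v using Finsupp.induction_linear with
    | zero => exact ⟨0, by rw [map_zero, map_zero]⟩
    | add v w hv hw =>
      obtain ⟨a, ha⟩ := hv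
      obtain ⟨b, hb⟩ := hw
      exact ⟨a + b, by rw [map_add, ha, hb, map_add]⟩
    | single b r =>
      refine ⟨DirectSum.lof R B _ b (segMk R p hp S i r), ?_⟩
      rw [hτ, segMap_mk, Finsupp.lsingle_apply]

end IsCellular

/-- A segment is the start of a short exact sequence with acyclic middle term that ends in the
segment shifted by one degree. -/
theorem exists_seg_shift (M : Type u) [AddCommGroup M] [Module R M] (p : R) (hp : p * p = 0)
    (S T : ℕ → Prop) [DecidablePred S] [DecidablePred T] (h0 : ¬ T 0) (hT : ∀ i, T (i + 1) ↔ S i) :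
    ∃ (B : Ch R) (f : seg M p hp S ⟶ B) (g : B ⟶ seg M p hp T),
      (∀ i, Function.Injective (f.f i).hom) ∧ (∀ i, Function.Surjective (g.f i).hom) ∧
      (∀ i, Function.Exact (f.f i).hom (g.f i).hom) ∧ IsAcyclic B := by
  have hk (i) (x : M) :
      segMk M p hp S i (segEv M p hp T (i + 1) (segMk M p hp T (i + 1) x)) = segMk M p hp S i x := by
    by_cases h : S i
    · rw [segEv_mk ((hT i).2 h)]
    · exact seg_eq_of_neg h _ _
  have hk' (i) (x) :
      segEv M p hp S i (segMk M p hp S i (segEv M p hp T (i + 1) x)) = segEv M p hp T (i + 1) x := by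
    by_cases h : S i
    · rw [segEv_mk h]
    · rw [segEv_neg h, segEv_neg (mt (hT i).1 h)]
  have hd2 (S : ℕ → Prop) [DecidablePred S] (i) (x : (seg M p hp S).X (i + 2)) :
      ((seg M p hp S).d (i + 1) i).hom (((seg M p hp S).d (i + 2) (i + 1)).hom x) = 0 :=
    d_d_apply _ _ _ _ x
  let σ (i : ℕ) : (seg M p hp T).X (i + 1) →ₗ[R] (seg M p hp S).X i :=
    segMk M p hp S i ∘ₗ segEv M p hp T (i + 1)
  have hσ (i x) : σ i x = segMk M p hp S i (segEv M p hp T (i + 1) x) := rfl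
  -- The differential of the cone on the identity: `σ` identifies degree `i + 1` of `T` with degree
  -- `i` of `S`, and the sign makes the square zero.
  let d (i : ℕ) : ((seg M p hp S).X (i + 1) × (seg M p hp T).X (i + 1)) →ₗ[R]
      ((seg M p hp S).X i × (seg M p hp T).X i) :=
    ((((seg M p hp S).d (i + 1) i).hom).coprod (σ i)).prod
      (-(((seg M p hp T).d (i + 1) i).hom ∘ₗ LinearMap.snd R _ _))
  have hd (i x y) : d i (x, y) = (((seg M p hp S).d (i + 1) i).hom x + σ i y,
    -((seg M p hp T).d (i + 1) i).hom y) := rfl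
  let B : Ch R := ofC (fun i => ModuleCat.of R ((seg M p hp S).X i × (seg M p hp T).X i)) d (by
    rintro i ⟨x, y⟩
    refine (congrArg (d i) (hd (i + 1) x y)).trans ?_
    rw [hd, map_add, map_neg, map_neg, hd2 T, hd2 S, seg_d, hσ, hk', hσ, seg_d, hk]
    simp)
  have hBd (i x y) : (B.d (i + 1) i).hom ((x, y) : (seg M p hp S).X (i + 1) × _) =
      (((seg M p hp S).d (i + 1) i).hom x + σ i y,
        -((seg M p hp T).d (i + 1) i).hom y) := ofC_d (fun i => ModuleCat.of R ((seg M p hp S).X i × (seg M p hp T).X i)) d _ i (x, y)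
  -- The factors `(-1)^i` absorb the sign in the cone, since the shifted segment carries `p` and not
  -- `-p`.
  refine ⟨B, homMk (W := B) (fun i => LinearMap.inl R ((seg M p hp S).X i) ((seg M p hp T).X i))
    fun i x => ?_, homMk (V := B) (fun i => (-1 : R) ^ i •
      LinearMap.snd R ((seg M p hp S).X i) ((seg M p hp T).X i)) fun i x => ?_,
    fun i x y h => ?_, fun i y => ?_, fun i x => ?_, ?_⟩
  · refine (hBd i x 0).trans ?_
    rw [map_zero, map_zero, neg_zero, add_zero]
    rfl
  · obtain ⟨x, y⟩ := x
    refine Eq.trans ?_ (congrArg ((-1 : R) ^ i • LinearMap.snd R ((seg M p hp S).X i)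
      ((seg M p hp T).X i)) (hBd i x y)).symm
    change ((seg M p hp T).d (i + 1) i).hom ((-1 : R) ^ (i + 1) • y) = (-1 : R) ^ i • -_
    rw [map_smul, pow_succ, mul_smul, neg_one_smul]
  · exact congrArg Prod.fst h
  · refine ⟨((0, (-1 : R) ^ i • y) : (seg M p hp S).X i × _), ?_⟩
    change (-1 : R) ^ i • (-1 : R) ^ i • y = y
    rw [← mul_smul, ← mul_pow]
    simp
  · obtain ⟨x, y⟩ := x
    constructor
    · intro (h : (-1 : R) ^ i • y = 0)
      have hy : y = 0 := by
        have := congrArg ((-1 : R) ^ i • ·) h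
        simpa only [← mul_smul, ← mul_pow, smul_zero, mul_neg, mul_one, neg_neg, one_pow,
          one_smul] using this
      exact ⟨x, Prod.ext rfl hy.symm⟩
    · rintro ⟨z, hz⟩
      have hy : y = 0 := (congrArg Prod.snd hz).symm
      change (-1 : R) ^ i • y = 0
      rw [hy, smul_zero]
  · rintro i ⟨x, y⟩ hxy
    refine ⟨((0, segMk M p hp T (i + 1) (segEv M p hp S i x)) :
      (seg M p hp S).X (i + 1) × _), ?_⟩
    refine (hBd i _ _).trans ?_
    rw [map_zero, zero_add, hσ, hk, segMk_ev]
    refine Prod.ext rfl ?_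
    rcases i with _ | i
    · exact seg_eq_of_neg h0 _ _
    · have h1 : ((seg M p hp S).d (i + 1) i).hom x + σ i y = 0 :=
        congrArg Prod.fst ((hBd i x y).symm.trans (hxy i))
      have h2 : segMk M p hp T (i + 1) (σ i y |> segEv M p hp S i) = y := by
        rw [hσ, hk', segMk_ev]
      change -((seg M p hp T).d (i + 2) (i + 1)).hom _ = y
      rw [seg_d, ← h2, ← neg_eq_of_add_eq_zero_right h1, map_neg, map_neg]
      congr 1
      rw [seg_d]
      by_cases h : S i
      · by_cases h' : S (i + 1)
        · rw [segEv_mk h, segEv_mk ((hT _).2 h')]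
        · rw [segEv_neg h', segEv_neg (mt (hT _).1 h'), smul_zero, map_zero, map_zero, map_zero, map_zero]
      · exact seg_eq_of_neg (mt (hT i).1 h) _ _

/-- The part of a complex in a single degree, as a segment. -/
theorem exists_restr_single_iso (W : Ch R) (n : ℕ) :
    ∃ φ : restr W (· = n) ⟶ seg (W.X n) (0 : R) (zero_mul 0) (· = n),
      ∀ i, Function.Bijective (φ.f i).hom := by
  let c (i : ℕ) : W.X i →ₗ[R] W.X n :=
    if h : i = n then (W.XIsoOfEq h).hom.hom else 0
  have hc (x : W.X n) : c n x = x := by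
    simp only [c, dif_pos, HomologicalComplex.XIsoOfEq_rfl]
    rfl
  refine ⟨homMk (fun i => segMk (W.X n) 0 (zero_mul 0) (· = n) i ∘ₗ c i ∘ₗ restrEv W (· = n) i)
    fun i x => ?_, fun i => ?_⟩
  · rw [seg_d, restr_d]
    simp only [LinearMap.comp_apply, zero_smul]
    by_cases h : i = n
    · rw [restrEv_neg (S := (· = n)) (i := i + 1) (by omega)]
      simp
    · exact seg_eq_of_neg (p := (0 : R)) (hp := zero_mul 0) (S := (· = n)) h _ _
  · by_cases h : i = n
    · subst h
      refine ⟨fun x y hxy => restrEv_injective i ?_, fun y => ⟨restrMk W (· = i) i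
        (segEv (W.X i) 0 (zero_mul 0) (· = i) i y), segEv_injective i ?_⟩⟩
      · have := congrArg (segEv (W.X i) (0 : R) (zero_mul 0) (· = i) i) hxy
        simp only [homMk_f, LinearMap.comp_apply] at this
        rwa [segEv_mk (S := (· = i)) rfl, segEv_mk (S := (· = i)) rfl, hc, hc] at this
      · simp only [homMk_f, LinearMap.comp_apply]
        rw [segEv_mk (S := (· = i)) rfl, restrEv_mk (S := (· = i)) rfl, hc]
    · exact ⟨fun x y _ => restr_eq_of_neg (S := (· = n)) h _ _,
        fun y => ⟨0, seg_eq_of_neg (S := (· = n)) h _ _⟩⟩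

/-! ### Attaching cells, and the sphere in degree one -/

namespace IsCellular
variable {A : Ch R}

theorem seg_shift {M : Type u} [AddCommGroup M] [Module R M] {p : R} {hp : p * p = 0}
    {S : ℕ → Prop} [DecidablePred S] (h : IsCellular A (seg M p hp S)) (T : ℕ → Prop)
    [DecidablePred T] (h0 : ¬ T 0) (hT : ∀ i, T (i + 1) ↔ S i) :
    IsCellular A (seg M p hp T) := by
  obtain ⟨B, f, g, hf, hg, hfg, hB⟩ := exists_seg_shift M p hp S T h0 hT
  exact of_shortExact f g hf hg hfg h (of_isAcyclic hB)

/-- A complex is cellular if a skeleton and the attaching spheres of the cells in higher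
degrees are. -/
theorem of_attach (W : Ch R) (r : ℕ) (h0 : IsCellular A (restr W (· ≤ r)))
    (h : ∀ n ≥ r, IsCellular A (seg (W.X (n + 1)) (0 : R) (zero_mul 0) (· = n))) :
    IsCellular A W := by
  refine of_skeleta W (fun j => r + j) (fun j => by omega) (fun i => ⟨i, by omega⟩) fun j => ?_
  induction j with
  | zero => exact h0
  | succ j ih =>
    obtain ⟨φ, hφ⟩ := exists_restr_single_iso W (r + j + 1)
    -- Cells of degree `r + j + 1` are attached along spheres one degree lower.
    obtain ⟨B, f, g, hf, hg, hfg, hB⟩ := exists_seg_shift (W.X (r + j + 1)) (0 : R) (zero_mul 0)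
      (· = r + j) (· = r + j + 1) (by omega) (fun i => by omega)
    exact extension_restr (S := (· ≤ r + j)) (fun i => by omega) (fun i _ => by omega)
      (fun i _ => by omega) φ hφ f g hf hg hfg hB ih (h _ (by omega))

variable {p : R} {hp : p * p = 0}

/-- The degrees are tiled by blocks of length `n + 1`. Each block is glued to the previous ones
along its desuspension, which starts at the last degree already filled. -/
theorem constC_of_seg {n : ℕ} (h : IsCellular A (seg R p hp (· ≤ n))) :
    IsCellular A (constC R p hp) := by
  have hs : ∀ m, IsCellular A (seg R p hp (fun i => m ≤ i ∧ i ≤ m + n)) := by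
    intro m
    induction m with
    | zero => simpa using h
    | succ m ih => exact ih.seg_shift _ (by omega) (fun i => by omega)
  refine of_skeleta _ (fun j => j * (n + 1) + n) (fun j => by rw [Nat.succ_mul]; omega)
    (fun i => ⟨i, by nlinarith⟩) fun j => ?_
  induction j with
  | zero => simpa using h
  | succ j ih =>
    obtain ⟨B, f, g, hf, hg, hfg, hB⟩ := exists_seg_shift R p hp
      (fun i => j * (n + 1) + n ≤ i ∧ i ≤ j * (n + 1) + n + n)
      (fun i => j * (n + 1) + n + 1 ≤ i ∧ i ≤ j * (n + 1) + n + 1 + n)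
      (by omega) (fun i => by omega)
    refine extension_restr (S := (· ≤ j * (n + 1) + n)) (fun i => ?_) (fun i _ => by omega)
      (fun i _ => by omega) (𝟙 _) (fun i => Function.bijective_id) f g hf hg hfg hB ih (hs _)
    rw [Nat.succ_mul]
    omega

/-- Adding to `K_∞` a generator in degree 1 whose boundary is the generator in degree 0 gives a
complex `E` weakly equivalent to the suspension of `K_∞`. Both are cellular, and the quotient `E /
K_∞` is the sphere. -/
theorem sphere_of_constC (h : IsCellular A (constC R p hp)) :
    IsCellular A (seg R (0 : R) (zero_mul 0) (· = 1)) := by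
  have h1 : IsCellular A (seg R p hp (fun _ => True)) :=
    weakEquiv_source (restrι _ _ fun _ _ => trivial) (quasiIso_of_bijective _ fun i =>
      ⟨restrEv_injective i, fun y => ⟨restrMk _ _ i y, restrEv_mk (S := fun _ => True) trivial y⟩⟩) h
  have h2 : IsCellular A (seg R p hp (fun i => 1 ≤ i)) :=
    h1.seg_shift _ (by omega) (fun i => by simp)
  let Q := seg R (0 : R) (zero_mul 0) (· = 1)
  let ev (i : ℕ) : Q.X i →ₗ[R] R := segEv R (0 : R) (zero_mul 0) (· = 1) i
  have hev {i : ℕ} (hi : i ≠ 1) (y : Q.X i) : ev i y = 0 := segEv_neg (S := (· = 1)) hi y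
  let d (i : ℕ) : (R × Q.X (i + 1)) →ₗ[R] (R × Q.X i) :=
    (LinearMap.coprod (LinearMap.lsmul R R p) (ev (i + 1))).prod 0
  have hd (i x y) : d i (x, y) = (p • x + ev (i + 1) y, 0) := rfl
  let E : Ch R := ofC (fun i => ModuleCat.of R (R × Q.X i)) d (by
    rintro i ⟨x, y⟩
    refine (congrArg (d i) (hd (i + 1) x y)).trans ?_
    rw [hd, map_zero, hev (by omega), add_zero, add_zero, ← mul_smul, hp, zero_smul]
    rfl)
  have hE (i x y) : (E.d (i + 1) i).hom ((x, y) : R × Q.X (i + 1)) =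
      (p • x + ev (i + 1) y, (0 : Q.X i)) :=
    ofC_d (fun i => ModuleCat.of R (R × Q.X i)) d _ i (x, y)
  let q : E ⟶ seg R p hp (fun i => 1 ≤ i) :=
    homMk (V := E) (fun i => segMk R p hp (fun i => 1 ≤ i) i ∘ₗ LinearMap.fst R R (Q.X i)) (by
      rintro i ⟨x, y⟩
      refine Eq.trans ?_ (congrArg (segMk R p hp (fun i => 1 ≤ i) i ∘ₗ LinearMap.fst R R (Q.X i))
        (hE i x y)).symm
      rw [seg_d]
      by_cases hi : 1 ≤ i
      · change segMk R p hp _ i (p • segEv R p hp _ (i + 1) (segMk R p hp _ (i + 1) x)) =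
          segMk R p hp _ i (p • x + ev (i + 1) y)
        rw [segEv_mk (S := fun i => 1 ≤ i) (by omega), hev (by omega), add_zero]
      · exact seg_eq_of_neg hi _ _)
  have hq : QuasiIso q := by
    -- The kernel of `q` is `R ← R` in degrees 0 and 1 with the identity as differential.
    refine quasiIso_of_surjective q (fun i y => ?_) ?_
    · obtain ⟨x, rfl⟩ := segMk_surjective i y
      exact ⟨((x, 0) : R × Q.X i), rfl⟩
    · rintro i ⟨x, y⟩ hxy (h0 : segMk R p hp _ i x = 0)
      rcases i with _ | i
      · refine ⟨((0, segMk R 0 (zero_mul 0) (· = 1) 1 x) : R × Q.X 1), map_zero (segMk R p hp _ 1), ?_⟩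
        refine (hE 0 _ _).trans (Prod.ext ?_ (seg_eq_of_neg (S := (· = 1)) (by omega) _ _))
        change p • 0 + segEv R 0 (zero_mul 0) (· = 1) 1 (segMk R 0 (zero_mul 0) (· = 1) 1 x) = x
        rw [segEv_mk (S := (· = 1)) rfl, smul_zero, zero_add]
      · have hx : x = 0 := by
          have := congrArg (segEv R p hp (fun i => 1 ≤ i) (i + 1)) h0
          rwa [segEv_mk (S := fun i => 1 ≤ i) (by omega), map_zero] at this
        have hy : p • x + ev (i + 1) y = 0 := congrArg Prod.fst ((hE i x y).symm.trans (hxy i))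
        rw [hx, smul_zero, zero_add] at hy
        refine ⟨0, map_zero _, ?_⟩
        rw [map_zero]
        exact Prod.ext hx.symm (segEv_injective (i + 1) ((map_zero (ev (i + 1))).trans hy.symm))
  have hEc : IsCellular A E := weakEquiv_source q hq h2
  refine of_shortExact (homMk (W := E) (fun i => LinearMap.inl R R (Q.X i)) fun i x => ?_)
    (homMk (V := E) (fun i => LinearMap.snd R R (Q.X i)) ?_) (fun i x y hxy => ?_) (fun i y => ?_)
    (fun i x => ?_) h hEc
  · refine (hE i x 0).trans ?_
    rw [map_zero, add_zero, constC_d]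
    rfl
  · rintro i ⟨x, y⟩
    refine Eq.trans ?_ (congrArg (LinearMap.snd R R (Q.X i)) (hE i x y)).symm
    rw [seg_d, zero_smul, map_zero]
    rfl
  · exact congrArg Prod.fst hxy
  · exact ⟨((0, y) : R × Q.X i), rfl⟩
  · obtain ⟨x, y⟩ := x
    constructor
    · intro (hy : y = 0)
      exact ⟨x, Prod.ext rfl hy.symm⟩
    · rintro ⟨z, hz⟩
      exact (congrArg Prod.snd hz).symm

end IsCellular

/-! ### Free resolutions -/

/-- A term of a resolution of `Y`, with its submodule of cycles and its map to `Y`. -/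
structure ResolutionStage (Y : Ch R) (n : ℕ) where
  /-- The term. -/
  P : ModuleCat.{u} R
  /-- The submodule of cycles. -/
  Z : Submodule R P
  /-- The map to the resolved complex. -/
  f : P →ₗ[R] Y.X n

namespace ResolutionStage
variable {Y : Ch R} {n : ℕ} (s : ResolutionStage Y n)

/-- The generators of the next term. -/
def Gen : Type u := {t : Y.X (n + 1) × s.Z // (Y.d (n + 1) n).hom t.1 = s.f t.2.1}

/-- The differential from the next term to the cycles. -/
noncomputable def bd : (s.Gen →₀ R) →ₗ[R] s.Z := Finsupp.linearCombination R fun t => t.1.2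

/-- The next term of the resolution. -/
noncomputable def next : ResolutionStage Y (n + 1) where
  P := ModuleCat.of R (s.Gen →₀ R)
  Z := LinearMap.ker s.bd
  f := Finsupp.linearCombination R fun t => t.1.1

/-- The differential of the resolution. -/
noncomputable def diff : s.next.P →ₗ[R] s.P := s.Z.subtype ∘ₗ s.bd

theorem diff_eq_zero_iff (x : s.next.P) : s.diff x = 0 ↔ x ∈ s.next.Z :=
  (Submodule.coe_eq_zero (x := s.bd x)).trans LinearMap.mem_ker.symm

theorem diff_mem (x : s.next.P) : s.diff x ∈ s.Z := (s.bd x).2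

theorem d_f (x : s.next.P) : (Y.d (n + 1) n).hom (s.next.f x) = s.f (s.diff x) := by
  refine LinearMap.congr_fun (f := (Y.d (n + 1) n).hom ∘ₗ s.next.f) (g := s.f ∘ₗ s.diff) ?_ x
  refine Finsupp.lhom_ext' fun t => LinearMap.ext_ring ?_
  change (Y.d (n + 1) n).hom (Finsupp.linearCombination R (fun t : s.Gen => t.1.1)
    (Finsupp.single t 1)) = s.f (s.Z.subtype (Finsupp.linearCombination R
      (fun t : s.Gen => t.1.2) (Finsupp.single t 1)))
  rw [Finsupp.linearCombination_single, Finsupp.linearCombination_single, one_smul, one_smul]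
  exact t.2

/-- The compatible pair is itself one of the generators. With `y` bounding the image of `z` this
gives injectivity on homology; with `z = 0` it gives surjectivity. -/
theorem exists_lift (y : Y.X (n + 1)) (z : s.P) (hz : z ∈ s.Z)
    (h : (Y.d (n + 1) n).hom y = s.f z) : ∃ x, s.next.f x = y ∧ s.diff x = z := by
  let t : s.Gen := ⟨(y, ⟨z, hz⟩), h⟩
  refine ⟨Finsupp.single t (1 : R), ?_, ?_⟩
  · exact (Finsupp.linearCombination_single R 1 t).trans (one_smul R _)
  · exact congrArg s.Z.subtype ((Finsupp.linearCombination_single R 1 t).trans (one_smul R _))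

end ResolutionStage

/-- A complex has a resolution with free terms in positive degrees and a prescribed term in
degree zero that is onto in homology. -/
theorem exists_resolution (Y : Ch R) (P₀ : ModuleCat.{u} R) (f₀ : P₀ →ₗ[R] Y.X 0)
    (h₀ : ∀ y, ∃ x y', y = f₀ x + (Y.d 1 0).hom y') :
    ∃ (P : Ch R) (f : P ⟶ Y), QuasiIso f ∧ Nonempty (P₀ ≃ₗ[R] P.X 0) ∧
      ∀ n, ∃ B : Type u, Nonempty ((B →₀ R) ≃ₗ[R] P.X (n + 1)) := by
  let s : ∀ n, ResolutionStage Y n :=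
    fun n => Nat.rec ⟨P₀, ⊤, f₀⟩ (fun _ s => s.next) n
  let P : Ch R := ofC (fun n => (s n).P) (fun n => (s n).diff) fun n x =>
    ((s n).diff_eq_zero_iff _).2 ((s (n + 1)).diff_mem x)
  have hd (n) (x : (s (n + 1)).P) : (P.d (n + 1) n).hom x = (s n).diff x :=
    ofC_d (fun n => (s n).P) (fun n => (s n).diff) _ n x
  have hz (n) (x : (s n).P) (hx : IsCycle P n x) : x ∈ (s n).Z := by
    rcases n with _ | n
    · exact Submodule.mem_top
    · exact ((s n).diff_eq_zero_iff x).1 ((hd n x).symm.trans (hx n))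
  let f : P ⟶ Y := homMk (V := P) (fun n => (s n).f) fun n x =>
    ((s n).d_f x).trans (congrArg (s n).f (hd n x).symm)
  refine ⟨P, f, ?_, ⟨LinearEquiv.refl R P₀⟩, fun n => ⟨(s n).Gen, ⟨LinearEquiv.refl R _⟩⟩⟩
  rw [quasiIso_iff_bijective]
  refine fun i => ⟨(homologyMap_injective_iff f i).2 fun v hv w' hw' => ?_,
    (homologyMap_surjective_iff f i).2 fun w hw => ?_⟩
  · obtain ⟨x, -, hx⟩ := (s i).exists_lift w' v (hz i v hv) hw'
    exact ⟨x, (hd i x).trans hx⟩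
  · rcases i with _ | i
    · obtain ⟨x, y', h⟩ := h₀ w
      exact ⟨x, isCycle_zero _ _, y', h⟩
    · obtain ⟨x, hx, hx'⟩ := (s i).exists_lift w 0 (zero_mem _) ((hw i).trans (map_zero _).symm)
      refine ⟨x, isCycle_succ ((hd i x).trans hx'), 0, ?_⟩
      rw [map_zero, add_zero]
      exact hx.symm

/-! ### Complexes built from spheres -/

namespace IsCellular
variable {A : Ch R}

theorem restr_le_of_seg (W : Ch R) (r : ℕ) (hW : ∀ i < r, Subsingleton (W.X i))
    (h : IsCellular A (seg (W.X r) (0 : R) (zero_mul 0) (· = r))) :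
    IsCellular A (restr W (· ≤ r)) := by
  obtain ⟨φ, hφ⟩ := exists_restr_single_iso W r
  refine weakEquiv_source (restrMap (𝟙 W) (· ≤ r) (· = r) fun i _ _ => by omega)
    (quasiIso_of_bijective _ fun i => ?_) (weakEquiv_source φ (quasiIso_of_bijective φ hφ) h)
  by_cases hi : i = r
  · refine ⟨fun x y hxy => restrEv_injective i ?_,
      fun y => ⟨restrMk W _ i (restrEv W _ i y), restrEv_injective i ?_⟩⟩
    · have := congrArg (restrEv W (· = r) i) hxy
      simp only [restrMap_apply, id_f_apply] at this
      rwa [restrEv_mk (S := (· = r)) hi, restrEv_mk (S := (· = r)) hi] at this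
    · rw [restrMap_apply, id_f_apply, restrEv_mk (S := (· = r)) hi,
        restrEv_mk (S := (· ≤ r)) hi.le]
  · refine ⟨fun x y _ => restrEv_injective i ?_,
      fun y => ⟨0, restr_eq_of_neg (S := (· = r)) hi _ _⟩⟩
    by_cases hi' : i ≤ r
    · have := hW i (by omega)
      exact Subsingleton.elim _ _
    · rw [restrEv_neg (S := (· ≤ r)) hi', restrEv_neg (S := (· ≤ r)) hi']

theorem sphere_of_le {m n : ℕ} (hmn : m ≤ n)
    (h : IsCellular A (seg R (0 : R) (zero_mul 0) (· = m))) :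
    IsCellular A (seg R (0 : R) (zero_mul 0) (· = n)) := by
  induction n, hmn using Nat.le_induction with
  | base => exact h
  | succ n _ ih => exact ih.seg_shift _ (by omega) (fun i => by omega)

/-- Everything is cellular with respect to the ring itself. -/
theorem of_sphere_zero (h : IsCellular A (seg R (0 : R) (zero_mul 0) (· = 0))) (Y : Ch R) :
    IsCellular A Y := by
  obtain ⟨P, f, hf, ⟨e⟩, hB⟩ := exists_resolution Y (ModuleCat.of R (Y.X 0 →₀ R))
    (Finsupp.linearCombination R id) fun y => ⟨Finsupp.single y 1, 0, by
      rw [Finsupp.linearCombination_single]; simp⟩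
  refine weakEquiv_target f hf (of_attach P 0 (restr_le_of_seg P 0 (by omega) ?_) fun n _ => ?_)
  · exact seg_of_linearEquiv e (h.seg_finsupp _)
  · obtain ⟨B, ⟨e⟩⟩ := hB n
    exact seg_of_linearEquiv e ((h.sphere_of_le n.zero_le).seg_finsupp _)

/-- Complexes without homology in degree zero are cellular with respect to the suspension of the
ring. -/
theorem of_sphere_one (h : IsCellular A (seg R (0 : R) (zero_mul 0) (· = 1))) (Y : Ch R)
    (hY : ∀ y, ∃ y', (Y.d 1 0).hom y' = y) : IsCellular A Y := by
  -- As `H₀(Y) = 0`, the resolution may start with the zero module, so only cells of degree at least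
  -- 1 occur.
  obtain ⟨P, f, hf, ⟨e⟩, hB⟩ := exists_resolution Y (ModuleCat.of R PUnit) 0 fun y => by
    obtain ⟨y', rfl⟩ := hY y
    exact ⟨0, y', by simp⟩
  refine weakEquiv_target f hf (of_attach P 1 (restr_le_of_seg P 1 (fun i hi => ?_) ?_)
    fun n hn => ?_)
  · obtain rfl : i = 0 := by omega
    exact e.symm.toEquiv.subsingleton (β := PUnit)
  · obtain ⟨B, ⟨e⟩⟩ := hB 0
    exact seg_of_linearEquiv e (h.seg_finsupp _)
  · obtain ⟨B, ⟨e⟩⟩ := hB n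
    exact seg_of_linearEquiv e ((h.sphere_of_le hn).seg_finsupp _)

end IsCellular

/-! ### Homotopy fibres -/

/-- Every complex receives a map from an acyclic complex that is onto in positive degrees. -/
theorem exists_path (Y : Ch R) : ∃ (P : Ch R) (g : P ⟶ Y), IsAcyclic P ∧
    ∀ i, Function.Surjective (g.f (i + 1)).hom := by
  -- The path complex has terms `Y_{i+1} × Y_i`, with the second factor dropped in degree 0 to make
  -- it acyclic there; the image in degree 0 is then only the boundaries.
  let Q := restr Y (0 < ·)
  let ev (i : ℕ) : Q.X i →ₗ[R] Y.X i := restrEv Y (0 < ·) i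
  let d (i : ℕ) : (Y.X (i + 2) × Q.X (i + 1)) →ₗ[R] (Y.X (i + 1) × Q.X i) :=
    (ev (i + 1) ∘ₗ LinearMap.snd R _ _).prod 0
  have hd (i x y) : d i (x, y) = (ev (i + 1) y, 0) := rfl
  let P : Ch R := ofC (fun i => ModuleCat.of R (Y.X (i + 1) × Q.X i)) d (by
    rintro i ⟨x, y⟩
    refine (congrArg (d i) (hd (i + 1) x y)).trans ?_
    rw [hd, map_zero]
    rfl)
  have hP (i x y) : (P.d (i + 1) i).hom ((x, y) : Y.X (i + 2) × Q.X (i + 1)) =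
      (ev (i + 1) y, (0 : Q.X i)) :=
    ofC_d (fun i => ModuleCat.of R (Y.X (i + 1) × Q.X i)) d _ i (x, y)
  refine ⟨P, homMk (V := P) (fun i => (Y.d (i + 1) i).hom.coprod (ev i)) ?_, ?_, fun i y => ?_⟩
  · rintro i ⟨x, y⟩
    refine Eq.trans ?_ (congrArg ((Y.d (i + 1) i).hom.coprod (ev i)) (hP i x y)).symm
    change (Y.d (i + 1) i).hom ((Y.d (i + 2) (i + 1)).hom x + ev (i + 1) y) =
      (Y.d (i + 1) i).hom (ev (i + 1) y) + ev i 0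
    rw [map_add, d_d_apply, zero_add, map_zero, add_zero]
  · rintro i ⟨x, y⟩ hxy
    refine ⟨((0, restrMk Y _ (i + 1) x) : Y.X (i + 2) × Q.X (i + 1)), ?_⟩
    refine (hP i _ _).trans (Prod.ext (restrEv_mk (S := (0 < ·)) (by omega) x) ?_)
    rcases i with _ | i
    · exact restr_eq_of_neg (S := (0 < ·)) (by omega) _ _
    · refine restrEv_injective (i + 1) ?_
      exact (map_zero _).trans (congrArg Prod.fst ((hP i x y).symm.trans (hxy i))).symm
  · refine ⟨((0, restrMk Y _ (i + 1) y) : Y.X (i + 2) × Q.X (i + 1)), ?_⟩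
    change (Y.d (i + 1 + 1) (i + 1)).hom 0 + ev (i + 1) (restrMk Y (0 < ·) (i + 1) y) = y
    rw [map_zero, zero_add]
    exact restrEv_mk (S := (0 < ·)) (by omega) y

/-- The map out of a product with given components. -/
def prodDesc {V W Y : Ch R} (f : V ⟶ Y) (g : W ⟶ Y) : prodC V W ⟶ Y :=
  homMk (V := prodC V W) (fun i => (f.f i).hom.coprod (g.f i).hom) (by
    rintro i ⟨x, y⟩
    change (Y.d (i + 1) i).hom ((f.f _).hom x + (g.f _).hom y) =
      (f.f i).hom ((V.d (i + 1) i).hom x) + (g.f i).hom ((W.d (i + 1) i).hom y)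
    rw [map_add, hom_d_apply, hom_d_apply])

theorem prodDesc_apply {V W Y : Ch R} (f : V ⟶ Y) (g : W ⟶ Y) (i : ℕ) (x : V.X i)
    (y : W.X i) :
    ((prodDesc f g).f i).hom ((x, y) : V.X i × W.X i) = (f.f i).hom x + (g.f i).hom y := rfl

/-- The target of a map from a cellular complex whose homotopy fibre has no homology in degrees
`-1` and `0` is cellular. -/
theorem IsCellular.of_fiber {A V Y : Ch R}
    (hA : IsCellular A (seg R (0 : R) (zero_mul 0) (· = 1))) (hV : IsCellular A V) (f : V ⟶ Y)
    (h₁ : ∀ y, ∃ x y', y = (f.f 0).hom x + (Y.d 1 0).hom y')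
    (h₂ : ∀ x y, (f.f 0).hom x = (Y.d 1 0).hom y →
      ∃ x', (V.d 1 0).hom x' = x ∧ (f.f 1).hom x' = y) : IsCellular A Y := by
  obtain ⟨P, g, hP, hg⟩ := exists_path Y
  let q := prodDesc f g
  let N : ∀ i, Submodule R ((prodC V P).X i) := fun i => LinearMap.ker (q.f i).hom
  -- A model of the homotopy fibre: adding the acyclic `P` makes the map onto `Y` degreewise
  -- surjective. The lifting condition `h₂` gives `H₀(F) = 0`.
  let F : Ch R := subC (prodC V P) N fun i x (hx : (q.f (i + 1)).hom x = 0) => by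
    change (q.f i).hom _ = 0
    rw [← hom_d_apply, hx, map_zero]
  have hF : IsCellular A F := by
    refine of_sphere_one hA F ?_
    rintro ⟨⟨x, y⟩, (hxy : (f.f 0).hom x + (g.f 0).hom y = 0)⟩
    obtain ⟨z, rfl⟩ := hP 0 y (isCycle_zero _ _)
    rw [← hom_d_apply, add_eq_zero_iff_eq_neg, ← map_neg] at hxy
    obtain ⟨x', hx', hx''⟩ := h₂ _ _ hxy
    refine ⟨⟨((x', z) : V.X 1 × P.X 1), ?_⟩, Subtype.ext (Prod.ext hx' rfl)⟩
    change (f.f 1).hom x' + (g.f 1).hom z = 0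
    rw [hx'', neg_add_cancel]
  refine of_shortExact (subι (prodC V P) N _) q (fun i x y h => Subtype.ext h) (fun i y => ?_)
    (fun i x => ?_) hF (hV.prod (of_isAcyclic hP))
  · rcases i with _ | i
    · obtain ⟨x, y', rfl⟩ := h₁ y
      obtain ⟨z, rfl⟩ := hg 0 y'
      refine ⟨((x, (P.d 1 0).hom z) : V.X 0 × P.X 0), ?_⟩
      rw [prodDesc_apply, hom_d_apply]
    · obtain ⟨z, rfl⟩ := hg i y
      refine ⟨((0, z) : V.X (i + 1) × P.X (i + 1)), ?_⟩
      rw [prodDesc_apply, map_zero, zero_add]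
  · constructor
    · intro hx
      exact ⟨⟨x, hx⟩, rfl⟩
    · rintro ⟨y, rfl⟩
      exact y.2

/-! ### Complexes generated by a segment -/

section segDesc
variable {M : Type u} [AddCommGroup M] [Module R M] {p : R} {hp : p * p = 0}
  {S : ℕ → Prop} [DecidablePred S] {Y : Ch R}

/-- The map out of a segment with given components. -/
noncomputable def segDesc (y : ∀ i, M →ₗ[R] Y.X i)
    (h : ∀ i x, S (i + 1) → (Y.d (i + 1) i).hom (y (i + 1) x) = if S i then p • y i x else 0) :
    seg M p hp S ⟶ Y :=
  homMk (fun i => y i ∘ₗ segEv M p hp S i) fun i x => by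
    rw [LinearMap.comp_apply, LinearMap.comp_apply, seg_d]
    by_cases hS : S (i + 1)
    · rw [h _ _ hS]
      by_cases hS' : S i
      · rw [if_pos hS', segEv_mk hS', map_smul]
      · rw [if_neg hS', segEv_neg hS', map_zero]
    · rw [segEv_neg hS, smul_zero, map_zero, map_zero, map_zero, map_zero, map_zero]

theorem segDesc_apply (y : ∀ i, M →ₗ[R] Y.X i) (h) (i : ℕ) (x : (seg M p hp S).X i) :
    ((segDesc (hp := hp) y h).f i).hom x = y i (segEv M p hp S i x) := rfl

end segDesc

/-- A module killed by the maximal ideal is a vector space over the residue field; a basis of it,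
read over `R`, has only relations with coefficients in that ideal. -/
theorem exists_residue_basis [IsLocalRing R] (N : Type u) [AddCommGroup N] [Module R N]
    (hN : ∀ r ∈ IsLocalRing.maximalIdeal R, ∀ x : N, r • x = 0) :
    ∃ (B : Type u) (b : B → N), Submodule.span R (Set.range b) = ⊤ ∧
      ∀ c : B →₀ R, Finsupp.linearCombination R b c = 0 →
        ∀ i, c i ∈ IsLocalRing.maximalIdeal R := by
  let m := IsLocalRing.maximalIdeal R
  have ht : Module.IsTorsionBySet R N m := fun x r => hN r r.2 x
  let : Module (R ⧸ m) N := ht.module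
  have : IsScalarTower R (R ⧸ m) N := ht.isScalarTower
  let : Field (R ⧸ m) := Ideal.Quotient.field m
  let b := Module.Basis.ofVectorSpace (R ⧸ m) N
  refine ⟨_, b, ?_, fun c hc i => ?_⟩
  · refine eq_top_iff.2 fun x _ => ?_
    rw [← b.linearCombination_repr x, Finsupp.linearCombination_apply]
    refine Submodule.sum_mem _ fun i _ => ?_
    obtain ⟨r, hr⟩ := Ideal.Quotient.mk_surjective (b.repr x i)
    beta_reduce
    rw [← hr, ← Ideal.Quotient.algebraMap_eq, algebraMap_smul]
    exact Submodule.smul_mem _ r (Submodule.subset_span ⟨i, rfl⟩)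
  · have h : Finsupp.linearCombination (R ⧸ m) b
        (c.mapRange (Ideal.Quotient.mk m) (map_zero _)) = 0 := by
      rw [← hc, Finsupp.linearCombination_apply, Finsupp.linearCombination_apply,
        Finsupp.sum_mapRange_index (h := fun i a => a • b i) fun i => zero_smul _ (b i)]
      refine Finsupp.sum_congr fun i _ => ?_
      rw [← Ideal.Quotient.algebraMap_eq, algebraMap_smul]
    have := DFunLike.congr_fun (b.linearIndependent (h.trans (map_zero _).symm)) i
    exact Ideal.Quotient.eq_zero_iff_mem.1 this

theorem exists_smul_eq_of_mem {p : R} {I : Ideal R} (hI : I = Ideal.span {p}) {B : Type*}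
    (c : B →₀ R) (hc : ∀ i, c i ∈ I) : ∃ c' : B →₀ R, p • c' = c := by
  induction c using Finsupp.induction with
  | zero => exact ⟨0, smul_zero p⟩
  | single_add i r c hi hr ih =>
    classical
    obtain ⟨s, hs⟩ := Ideal.mem_span_singleton.1 (hI ▸ hc i)
    have hi' := Finsupp.notMem_support_iff.1 hi
    rw [Finsupp.add_apply, Finsupp.single_eq_same, hi', add_zero] at hs
    obtain ⟨c', rfl⟩ := ih fun j => by
      by_cases hj : j = i
      · rw [hj, hi']
        exact zero_mem _
      · have := hc j
        rwa [Finsupp.add_apply, Finsupp.single_eq_of_ne hj, zero_add] at this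
    exact ⟨Finsupp.single i s + c', by rw [smul_add, Finsupp.smul_single, hs, smul_eq_mul]⟩

/-- A complex all of whose classes in degree zero are hit by a segment is cellular. -/
theorem IsCellular.of_seg [IsLocalRing R] {A Y : Ch R} {p : R} {hp : p * p = 0}
    (hm : IsLocalRing.maximalIdeal R = Ideal.span {p}) {n : ℕ}
    (hA : IsCellular A (seg R p hp (· ≤ n)))
    (hY : ∀ y, ∃ (g : seg R p hp (· ≤ n) ⟶ Y) (y' : Y.X 1),
      y = (g.f 0).hom (segMk R p hp (· ≤ n) 0 1) + (Y.d 1 0).hom y') : IsCellular A Y := by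
  rcases Nat.eq_zero_or_pos n with rfl | hn
  · refine of_sphere_zero (weakEquiv_target (X := seg R p hp (· ≤ 0)) (segDesc (fun i =>
      segMk R (0 : R) (zero_mul 0) (· = 0) i) fun i x h => by omega)
      (quasiIso_of_bijective _ fun i => ?_) hA) Y
    by_cases h : i = 0
    · refine ⟨fun x y hxy => segEv_injective i ?_, fun y => ⟨segMk R p hp _ i
        (segEv R 0 (zero_mul 0) (· = 0) i y), ?_⟩⟩
      · have := congrArg (segEv R (0 : R) (zero_mul 0) (· = 0) i) hxy
        rwa [segDesc_apply, segDesc_apply, segEv_mk (S := (· = 0)) h,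
          segEv_mk (S := (· = 0)) h] at this
      · rw [segDesc_apply, segEv_mk (S := (· ≤ 0)) h.le, segMk_ev]
    · exact ⟨fun x y _ => seg_eq_of_neg (S := (· ≤ 0)) (by omega) _ _,
        fun y => ⟨0, seg_eq_of_neg (S := (· = 0)) h _ _⟩⟩
  have hS := sphere_of_constC (constC_of_seg hA)
  let N := Y.X 0 ⧸ LinearMap.range (Y.d 1 0).hom
  let π : Y.X 0 →ₗ[R] N := Submodule.mkQ _
  have hπ (y) : π y = 0 ↔ ∃ y', (Y.d 1 0).hom y' = y :=
    (Submodule.Quotient.mk_eq_zero _).trans LinearMap.mem_range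
  -- In a segment with `n ≥ 1`, `p` times the generator in degree 0 is the boundary of the generator
  -- in degree 1.
  have hpN (x : N) : p • x = 0 := by
    obtain ⟨y, rfl⟩ := Submodule.mkQ_surjective _ x
    obtain ⟨g, y', rfl⟩ := hY y
    rw [← map_smul]
    refine (hπ _).2 ⟨(g.f 1).hom (segMk R p hp (· ≤ n) 1 1) + p • y', ?_⟩
    rw [map_add, hom_d_apply, seg_d, segEv_mk (S := (· ≤ n)) hn, smul_add, map_smul, map_smul,
      map_smul]
  obtain ⟨B, b, hb, hb'⟩ := exists_residue_basis N fun r hr x => by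
    rw [hm, Ideal.mem_span_singleton] at hr
    obtain ⟨r, rfl⟩ := hr
    rw [mul_comm, mul_smul, hpN, smul_zero]
  have hg (i : B) : ∃ g : seg R p hp (· ≤ n) ⟶ Y,
      π ((g.f 0).hom (segMk R p hp (· ≤ n) 0 1)) = b i := by
    obtain ⟨y, hy⟩ := Submodule.mkQ_surjective _ (b i)
    obtain ⟨g, y', rfl⟩ := hY y
    refine ⟨g, ?_⟩
    rw [← hy, eq_comm, ← sub_eq_zero, ← map_sub]
    exact (hπ _).2 ⟨y', by abel⟩
  choose g hg using hg
  let f₁ : seg (B →₀ R) p hp (· ≤ n) ⟶ Y := segDesc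
    (fun i => Finsupp.linearCombination R fun j => ((g j).f i).hom (segMk R p hp (· ≤ n) i 1))
    fun i x hi => by
      rw [if_pos (by omega)]
      refine LinearMap.congr_fun (f := (Y.d (i + 1) i).hom ∘ₗ Finsupp.linearCombination R fun j =>
        ((g j).f (i + 1)).hom (segMk R p hp (· ≤ n) (i + 1) 1)) (g := p •
        Finsupp.linearCombination R fun j => ((g j).f i).hom (segMk R p hp (· ≤ n) i 1)) ?_ x
      refine Finsupp.lhom_ext' fun j => LinearMap.ext_ring ?_
      simp only [LinearMap.comp_apply, LinearMap.smul_apply, Finsupp.lsingle_apply,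
        Finsupp.linearCombination_single, one_smul]
      rw [hom_d_apply, seg_d, segEv_mk (S := (· ≤ n)) hi, map_smul, map_smul]
  -- One sphere for each 1-cycle of `Y`, to make the map onto on cycles in degree 1.
  let Z := LinearMap.ker (Y.d 1 0).hom
  let f₂ : seg (Z →₀ R) (0 : R) (zero_mul 0) (· = 1) ⟶ Y := segDesc
    (fun i => match i with
      | 1 => Finsupp.linearCombination R Subtype.val
      | _ => 0)
    fun i x hi => by
      obtain rfl : i = 0 := by omega
      rw [if_neg (by omega)]
      refine LinearMap.congr_fun (f := (Y.d 1 0).hom ∘ₗ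
        Finsupp.linearCombination R (Subtype.val : Z → Y.X 1)) (g := 0) ?_ x
      refine Finsupp.lhom_ext' fun j => LinearMap.ext_ring ?_
      simp only [LinearMap.comp_apply, Finsupp.lsingle_apply,
        Finsupp.linearCombination_single, one_smul, LinearMap.zero_apply]
      exact j.2
  have hf₁ (c) : π ((f₁.f 0).hom c) =
      Finsupp.linearCombination R b (segEv (B →₀ R) p hp (· ≤ n) 0 c) := by
    rw [segDesc_apply]
    refine LinearMap.congr_fun (f := π ∘ₗ Finsupp.linearCombination R fun j =>
        ((g j).f 0).hom (segMk R p hp (· ≤ n) 0 1)) (g := Finsupp.linearCombination R b) ?_ _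
    refine Finsupp.lhom_ext' fun j => LinearMap.ext_ring ?_
    simp only [LinearMap.comp_apply, Finsupp.lsingle_apply,
      Finsupp.linearCombination_single, one_smul, hg]
  refine of_fiber hS ((hA.seg_finsupp B).prod (hS.seg_finsupp Z)) (prodDesc f₁ f₂)
    (fun y => ?_) ?_
  · have hy : π y ∈ Submodule.span R (Set.range b) := hb ▸ Submodule.mem_top
    rw [Finsupp.mem_span_range_iff_exists_finsupp] at hy
    obtain ⟨c, hc⟩ := hy
    have : π (y - (f₁.f 0).hom (segMk (B →₀ R) p hp (· ≤ n) 0 c)) = 0 := by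
      rw [map_sub, hf₁, segEv_mk (S := (· ≤ n)) n.zero_le, ← hc, sub_eq_zero]
      rfl
    obtain ⟨y', hy'⟩ := (hπ _).1 this
    refine ⟨((segMk (B →₀ R) p hp (· ≤ n) 0 c, 0) :
      (seg (B →₀ R) p hp (· ≤ n)).X 0 ×
        (seg (Z →₀ R) (0 : R) (zero_mul 0) (· = 1)).X 0), y', ?_⟩
    rw [prodDesc_apply, hy', map_zero, add_zero, add_sub_cancel]
  · rintro ⟨x, z⟩ y hxy
    obtain rfl : z = 0 := seg_eq_of_neg (S := (· = 1)) (by omega) _ _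
    rw [prodDesc_apply, map_zero, add_zero] at hxy
    have h0 := hf₁ x
    rw [hxy, (hπ _).2 ⟨y, rfl⟩] at h0
    -- The class of `x` maps to zero, so its coordinates are multiples of `p` and `x` bounds in the
    -- segments. The remaining discrepancy in degree 1 is a cycle, which a sphere corrects.
    obtain ⟨c, hc⟩ := exists_smul_eq_of_mem hm _ (hb' _ h0.symm)
    have hx : ((seg (B →₀ R) p hp (· ≤ n)).d 1 0).hom (segMk (B →₀ R) p hp (· ≤ n) 1 c) = x := by
      rw [seg_d, segEv_mk (S := (· ≤ n)) hn, hc, segMk_ev]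
    let z : Z := ⟨y - (f₁.f 1).hom (segMk (B →₀ R) p hp (· ≤ n) 1 c), by
      rw [LinearMap.mem_ker, map_sub, hom_d_apply, hx, hxy, sub_self]⟩
    have hz : (f₂.f 1).hom (segMk (Z →₀ R) (0 : R) (zero_mul 0) (· = 1) 1 (Finsupp.single z 1)) =
        z.1 := by
      rw [segDesc_apply, segEv_mk (S := (· = 1)) rfl]
      exact (Finsupp.linearCombination_single R 1 z).trans (one_smul R _)
    refine ⟨((segMk (B →₀ R) p hp (· ≤ n) 1 c, segMk (Z →₀ R) (0 : R) (zero_mul 0) (· = 1) 1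
      (Finsupp.single z 1)) : (seg (B →₀ R) p hp (· ≤ n)).X 1 ×
        (seg (Z →₀ R) (0 : R) (zero_mul 0) (· = 1)).X 1), ?_, ?_⟩
    · exact Prod.ext hx (seg_eq_of_neg (S := (· = 1)) (by omega) _ _)
    · rw [prodDesc_apply, hz, add_sub_cancel]

theorem IsCellular.trans {A B Y : Ch R} (hB : IsCellular A B) (hY : IsCellular B Y) :
    IsCellular A Y := by
  induction hY with
  | self => exact hB
  | sum I X _ ih => exact .sum I X ih
  | weakEquiv_target f hf _ ih => exact .weakEquiv_target f hf ih
  | weakEquiv_source f hf _ ih => exact .weakEquiv_source f hf ih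
  | quotient S hS _ _ ih₁ ih₂ => exact .quotient S hS ih₁ ih₂

/-! ### Minimal complexes -/

/-- Linear forms on a projective module over a local ring separate elements from submodules
containing the multiples by the maximal ideal. -/
theorem exists_form_eq_one [IsLocalRing R] {V : Type u} [AddCommGroup V] [Module R V]
    [Module.Projective R V] (L : Submodule R V)
    (hL : ∀ r ∈ IsLocalRing.maximalIdeal R, ∀ x : V, r • x ∈ L) (v : V) (hv : v ∉ L) :
    ∃ φ : V →ₗ[R] R, φ v = 1 ∧ ∀ y ∈ L, φ y ∈ IsLocalRing.maximalIdeal R := by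
  let m := IsLocalRing.maximalIdeal R
  have ht : Module.IsTorsionBySet R (V ⧸ L) m := fun x r => by
    obtain ⟨x, rfl⟩ := L.mkQ_surjective x
    rw [← map_smul]
    exact (Submodule.Quotient.mk_eq_zero L).2 (hL r r.2 x)
  let : Module (R ⧸ m) (V ⧸ L) := ht.module
  have : IsScalarTower R (R ⧸ m) (V ⧸ L) := ht.isScalarTower
  let : Field (R ⧸ m) := Ideal.Quotient.field m
  have hv' : L.mkQ v ≠ 0 := fun h => hv ((Submodule.Quotient.mk_eq_zero L).1 h)
  obtain ⟨f, hf⟩ : ∃ f : Module.Dual (R ⧸ m) (V ⧸ L), f (L.mkQ v) ≠ 0 := by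
    by_contra! h
    exact hv' ((Module.forall_dual_apply_eq_zero_iff (R ⧸ m) _).1 h)
  obtain ⟨φ, hφ⟩ := Module.projective_lifting_property (Algebra.linearMap R (R ⧸ m))
    ((f.restrictScalars R) ∘ₗ L.mkQ) Ideal.Quotient.mk_surjective
  have hφ' (x) : Ideal.Quotient.mk m (φ x) = f (L.mkQ x) := LinearMap.congr_fun hφ x
  -- A lift of a nonzero residue is a unit, so `φ` can be rescaled to take the value 1 at `v`.
  have hu : IsUnit (φ v) := by
    by_contra h
    refine hf ?_
    rw [← hφ']
    exact Ideal.Quotient.eq_zero_iff_mem.2 ((IsLocalRing.mem_maximalIdeal _).2 h)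
  obtain ⟨a, ha⟩ := hu.exists_left_inv
  refine ⟨a • φ, ha, fun y hy => ?_⟩
  refine Ideal.mul_mem_left _ a (Ideal.Quotient.eq_zero_iff_mem.1 ?_)
  rw [hφ', Submodule.mkQ_apply, (Submodule.Quotient.mk_eq_zero L).2 hy, map_zero]

section minimal
variable {X : Ch R} (δ : ∀ i, X.X (i + 1) →ₗ[R] X.X i)

/-- The composite of a sequence of maps down to degree zero. -/
def descend : ∀ i, X.X i →ₗ[R] X.X 0
  | 0 => LinearMap.id
  | i + 1 => descend i ∘ₗ δ i

theorem exists_descending_sequence (n : ℕ) (x : X.X n) :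
    ∃ e : ∀ i, X.X i, e n = x ∧ ∀ i < n, e i = δ i (e (i + 1)) := by
  induction n with
  | zero => exact ⟨Function.update 0 0 x, by simp, by omega⟩
  | succ n ih =>
    obtain ⟨e, he, he'⟩ := ih (δ n x)
    refine ⟨Function.update e (n + 1) x, by simp, fun i hi => ?_⟩
    rw [Function.update_of_ne (by omega)]
    by_cases h : i = n
    · subst h
      rw [Function.update_self, he]
    · rw [Function.update_of_ne (by omega), he' i (by omega)]

theorem descend_eq {n : ℕ} {e : ∀ i, X.X i} (he : ∀ i < n, e i = δ i (e (i + 1))) (i : ℕ)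
    (hi : i ≤ n) : descend δ i (e i) = e 0 := by
  induction i with
  | zero => rfl
  | succ i ih =>
    rw [descend, LinearMap.comp_apply, ← he i hi, ih (by omega)]

variable {δ} {p : R} (hp : p * p = 0)

/-- The generator in degree `n` goes to `x` and the lower ones to its successive images under `δ`;
this commutes with the differentials since `d = p δ`. -/
theorem exists_hom_of_seg (hδ : ∀ i x, (X.d (i + 1) i).hom x = p • δ i x) (n : ℕ) (x : X.X n) :
    ∃ (g : seg R p hp (· ≤ n) ⟶ X) (e : ∀ i, X.X i),
      (∀ i y, (g.f i).hom y = segEv R p hp (· ≤ n) i y • e i) ∧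
      ∀ i ≤ n, descend δ i (e i) = descend δ n x := by
  obtain ⟨e, he, he'⟩ := exists_descending_sequence δ n x
  refine ⟨segDesc (fun i => LinearMap.toSpanSingleton R _ (e i)) fun i r hi => ?_, e,
    fun i y => rfl, fun i hi => ?_⟩
  · rw [if_pos (by omega), LinearMap.toSpanSingleton_apply, LinearMap.toSpanSingleton_apply,
      map_smul, hδ, he' i (by omega), smul_comm]
  · rw [descend_eq δ he' i hi, ← he, descend_eq δ he' n le_rfl]

/-- For a minimal complex, some segment is a retract through which every class in degree zero
factors. -/
theorem exists_seg_of_minimal [IsLocalRing R]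
    (hm : IsLocalRing.maximalIdeal R = Ideal.span {p}) (hX : IsCofibrant X)
    (hb : ∃ N, Subsingleton (X.X N)) (h0 : Nontrivial (X.X 0))
    (hmin : ∀ i (x : X.X (i + 1)), ∃ z, (X.d (i + 1) i).hom x = p • z) :
    ∃ n, IsCellular X (seg R p hp (· ≤ n)) ∧ ∀ x : X.X 0, ∃ (g : seg R p hp (· ≤ n) ⟶ X)
      (y' : X.X 1), x = (g.f 0).hom (segMk R p hp (· ≤ n) 0 1) + (X.d 1 0).hom y' := by
  have hδ (i) : ∃ δ : X.X (i + 1) →ₗ[R] X.X i, ∀ x, (X.d (i + 1) i).hom x = p • δ x := by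
    -- Minimality puts the image of `d` in `p X_i`; projectivity lifts `d` along multiplication by
    -- `p`.
    have := hX (i + 1)
    obtain ⟨δ, hδ⟩ := Module.projective_lifting_property
      (LinearMap.lsmul R (X.X i) p).rangeRestrict
      ((X.d (i + 1) i).hom.codRestrict (LinearMap.range (LinearMap.lsmul R (X.X i) p))
        fun x => by
          obtain ⟨z, hz⟩ := hmin i x
          exact ⟨z, hz.symm⟩) (LinearMap.surjective_rangeRestrict _)
    exact ⟨δ, fun x => (congrArg Subtype.val (LinearMap.congr_fun hδ x)).symm⟩
  choose δ hδ using hδ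
  -- The composite from degree 0 is the identity, while the one from the vanishing `X_N` cannot be
  -- onto.
  obtain ⟨n, hn, hn'⟩ : ∃ n, Function.Surjective (descend δ n) ∧
      ¬ Function.Surjective (descend δ (n + 1)) := by
    by_contra! h
    have hs (n) : Function.Surjective (descend δ n) := by
      induction n with
      | zero => exact Function.surjective_id
      | succ n ih => exact h n ih
    obtain ⟨N, hN⟩ := hb
    exact not_subsingleton _ (hs N).subsingleton
  refine ⟨n, ?_, fun x => ?_⟩
  · let L := LinearMap.range (descend δ (n + 1)) ⊔ LinearMap.range (LinearMap.lsmul R (X.X 0) p)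
    -- Nakayama by hand: substituting the decomposition into itself once removes the `p`-term, as
    -- `p² = 0`.
    have hL : L ≠ ⊤ := fun hL => hn' fun x => by
      have key (x : X.X 0) : ∃ a b, descend δ (n + 1) a + p • b = x := by
        obtain ⟨_, ⟨a, rfl⟩, _, ⟨b, rfl⟩, h⟩ := Submodule.mem_sup.1 (hL ▸ Submodule.mem_top : x ∈ L)
        exact ⟨a, b, h⟩
      obtain ⟨a, b, rfl⟩ := key x
      obtain ⟨a', b', rfl⟩ := key b
      exact ⟨a + p • a', by rw [map_add, map_smul, smul_add, ← mul_smul, hp, zero_smul, add_zero]⟩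
    obtain ⟨v, hv⟩ : ∃ v, v ∉ L := by
      by_contra! h
      exact hL (eq_top_iff.2 fun v _ => h v)
    have := hX 0
    obtain ⟨φ, hφ, hφ'⟩ := exists_form_eq_one L (fun r hr x => by
      rw [hm, Ideal.mem_span_singleton] at hr
      obtain ⟨r, rfl⟩ := hr
      exact Submodule.mem_sup_right ⟨r • x, (mul_smul p r x).symm⟩) v hv
    obtain ⟨w, rfl⟩ := hn v
    obtain ⟨s, e, hs, he⟩ := exists_hom_of_seg hp hδ n w
    -- The retraction. Leaving degree `n + 1`, it commutes with `d` because `φ` sends the image of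
    -- the next composite into `(p)` and `p² = 0`.
    let r : X ⟶ seg R p hp (· ≤ n) :=
      homMk (fun i => segMk R p hp (· ≤ n) i ∘ₗ φ ∘ₗ descend δ i) fun i x => by
        simp only [LinearMap.comp_apply]
        rw [seg_d, hδ, map_smul (descend δ i), map_smul φ, smul_eq_mul,
          smul_eq_mul]
        by_cases hi : i + 1 ≤ n
        · rw [segEv_mk (S := (· ≤ n)) hi]
          rfl
        · rw [segEv_neg (S := (· ≤ n)) hi, mul_zero, map_zero]
          by_cases hi' : i = n
          · subst hi'
            have h1 : φ (descend δ (i + 1) x) ∈ Ideal.span {p} :=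
              hm ▸ hφ' _ (Submodule.mem_sup_left ⟨x, rfl⟩)
            obtain ⟨t, ht⟩ := Ideal.mem_span_singleton.1 h1
            rw [descend, LinearMap.comp_apply] at ht
            rw [ht, ← mul_assoc, hp, zero_mul, map_zero]
          · exact seg_eq_of_neg (S := (· ≤ n)) (by omega) _ _
    refine IsCellular.retract s r (hom_ext_apply fun i x => ?_) .self
    rw [comp_f_apply, hs, id_f_apply]
    by_cases hi : i ≤ n
    · change segMk R p hp _ i (φ (descend δ i _)) = x
      rw [map_smul, map_smul, he i hi, hφ, smul_eq_mul, mul_one, segMk_ev]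
    · exact seg_eq_of_neg (S := (· ≤ n)) hi _ _
  · obtain ⟨w, rfl⟩ := hn x
    obtain ⟨s, e, hs, he⟩ := exists_hom_of_seg hp hδ n w
    refine ⟨s, 0, ?_⟩
    rw [hs, segEv_mk (S := (· ≤ n)) n.zero_le, one_smul, ← he 0 n.zero_le, map_zero, add_zero]
    rfl

end minimal

/-! ### Splitting off contractible summands -/

section contraction
variable {X : Ch R} (h : ∀ j, X.X j →ₗ[R] X.X (j + 1))

/-- The composite of the differential with a map raising the degree. -/
def afterD : ∀ j, X.X j →ₗ[R] X.X j
  | 0 => 0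
  | j + 1 => h j ∘ₗ (X.d (j + 1) j).hom

/-- The complement of the contractible summand given by a partial contraction. -/
def contractionC : Ch R := subC X (fun j => LinearMap.ker (h j) ⊓ LinearMap.ker (afterD h j))
  fun j x hx => by
    refine ⟨hx.2, ?_⟩
    cases j with
    | zero => exact rfl
    | succ j =>
      change h j ((X.d (j + 1) j).hom _) = 0
      rw [d_d_apply, map_zero]

/-- The inclusion of the complement. -/
def contractionι : contractionC h ⟶ X := subι X _ _

theorem contractionι_injective (j : ℕ) : Function.Injective ((contractionι h).f j).hom :=
  fun _ _ => Subtype.ext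

variable {h}

/-- With `h² = 0` and `h d h = h`, the map `1 - d h - h d` is a projection onto the common kernel of
`h` and `h d`. -/
theorem exists_contraction_retraction (h₁ : ∀ j x, h (j + 1) (h j x) = 0)
    (h₂ : ∀ j x, h j ((X.d (j + 1) j).hom (h j x)) = h j x) (j : ℕ) :
    ∃ ρ : X.X j →ₗ[R] (contractionC h).X j, (∀ x, ρ (((contractionι h).f j).hom x) = x) ∧
      ∀ x, ((contractionι h).f j).hom (ρ x) =
        x - (X.d (j + 1) j).hom (h j x) - afterD h j x := by
  let ρ : X.X j →ₗ[R] X.X j := LinearMap.id - (X.d (j + 1) j).hom ∘ₗ h j - afterD h j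
  have hρ (x) : ρ x = x - (X.d (j + 1) j).hom (h j x) - afterD h j x := rfl
  have hmem (x) : ρ x ∈ LinearMap.ker (h j) ⊓ LinearMap.ker (afterD h j) := by
    refine ⟨?_, ?_⟩
    · rw [SetLike.mem_coe, LinearMap.mem_ker, hρ, map_sub, map_sub, h₂, sub_self, zero_sub,
        neg_eq_zero]
      cases j with
      | zero => exact map_zero _
      | succ j => exact h₁ j _
    · rw [SetLike.mem_coe, LinearMap.mem_ker]
      cases j with
      | zero => rfl
      | succ j =>
        change h j ((X.d (j + 1) j).hom (ρ x)) = 0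
        rw [hρ, map_sub, map_sub, map_sub, map_sub, d_d_apply, map_zero, sub_zero]
        exact sub_eq_zero.2 (h₂ j _).symm
  refine ⟨LinearMap.codRestrict _ ρ hmem, fun x => Subtype.ext ?_, fun x => rfl⟩
  obtain ⟨x, hx, hx'⟩ := x
  change x - (X.d (j + 1) j).hom (h j x) - afterD h j x = x
  rw [show h j x = 0 from hx, show afterD h j x = 0 from hx', map_zero, sub_zero, sub_zero]

theorem quasiIso_contractionι (h₁ : ∀ j x, h (j + 1) (h j x) = 0)
    (h₂ : ∀ j x, h j ((X.d (j + 1) j).hom (h j x)) = h j x) : QuasiIso (contractionι h) := by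
  refine quasiIso_of_injective _ (contractionι_injective h) fun i w hw => ?_
  obtain ⟨ρ, -, hρ⟩ := exists_contraction_retraction h₁ h₂ i
  refine ⟨h i w, ρ w, ?_⟩
  have : afterD h i w = 0 := by
    cases i with
    | zero => rfl
    | succ i =>
      obtain ⟨v, hv⟩ := hw i
      change h i ((X.d (i + 1) i).hom w) = 0
      rw [← hv]
      exact v.2.1
  rw [hρ, this]
  abel

end contraction

/-- A bounded complex of finitely generated projective modules with homology in degree zero has
a cellular segment that hits all its classes in degree zero. -/
theorem exists_seg_of_finite [IsLocalRing R] {p : R} (hp : p * p = 0)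
    (hm : IsLocalRing.maximalIdeal R = Ideal.span {p}) (N : ℕ) (k : ℕ) (X : Ch R)
    (hX : IsCofibrant X) (hfin : ∀ i, Module.Finite R (X.X i))
    (hb : ∀ i ≥ N, Subsingleton (X.X i))
    (hk : ∑ i ∈ Finset.range N, Module.finrank R (X.X i) < k)
    (hH : ∃ x, ∀ y, (X.d 1 0).hom y ≠ x) :
    ∃ n, IsCellular X (seg R p hp (· ≤ n)) ∧ ∀ x : X.X 0, ∃ (g : seg R p hp (· ≤ n) ⟶ X)
      (y' : X.X 1), x = (g.f 0).hom (segMk R p hp (· ≤ n) 0 1) + (X.d 1 0).hom y' := by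
  induction k generalizing X with
  | zero => omega
  | succ k ih =>
  obtain ⟨x₀, hx₀⟩ := hH
  by_cases hmin : ∀ i (x : X.X (i + 1)), ∃ z, (X.d (i + 1) i).hom x = p • z
  · refine exists_seg_of_minimal hp hm hX ⟨N, hb N le_rfl⟩ ⟨x₀, 0, fun h => hx₀ 0 ?_⟩ hmin
    rw [map_zero, h]
  push Not at hmin
  obtain ⟨i, e, he⟩ := hmin
  have := hX i
  -- A boundary `d e` outside `p X_i` has a form with value 1, so `h = φ(·) e` contracts the summand
  -- spanned by `e` and `d e`.
  obtain ⟨φ, hφ, -⟩ := exists_form_eq_one (LinearMap.range (LinearMap.lsmul R (X.X i) p))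
    (fun r hr x => by
      rw [hm, Ideal.mem_span_singleton] at hr
      obtain ⟨r, rfl⟩ := hr
      exact ⟨r • x, (mul_smul p r x).symm⟩) ((X.d (i + 1) i).hom e)
    (by rintro ⟨z, hz⟩; exact he z hz.symm)
  let h : ∀ j, X.X j →ₗ[R] X.X (j + 1) :=
    Function.update (fun j => 0) i (LinearMap.toSpanSingleton R _ e ∘ₗ φ)
  have hi (x) : h i x = φ x • e := by
    simp only [h, Function.update_self]
    rfl
  have hne {j} (hj : j ≠ i) (x) : h j x = 0 := by
    simp only [h, Function.update_of_ne hj]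
    rfl
  have h₁ (j x) : h (j + 1) (h j x) = 0 := by
    by_cases hj : j = i
    · exact hne (by omega) _
    · rw [hne hj, map_zero]
  have h₂ (j x) : h j ((X.d (j + 1) j).hom (h j x)) = h j x := by
    by_cases hj : j = i
    · subst hj
      rw [hi, hi, map_smul, map_smul, hφ, smul_eq_mul, mul_one]
    · rw [hne hj, hne hj]
  choose ρ hρ hρ' using exists_contraction_retraction h₁ h₂
  have hρs (j) : Function.Surjective (ρ j) := fun x => ⟨_, hρ j x⟩
  have hX' : IsCofibrant (contractionC h) := fun j => by
    have := hX j
    exact Module.Projective.of_split ((contractionι h).f j).hom (ρ j) (LinearMap.ext (hρ j))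
  have hfin' (j) : Module.Finite R ((contractionC h).X j) := by
    have := hfin j
    exact Module.Finite.of_surjective (ρ j) (hρs j)
  have hiN : i < N := by
    by_contra hN
    have := hb i (by omega)
    rw [Subsingleton.elim ((X.d (i + 1) i).hom e) 0, map_zero] at hφ
    exact zero_ne_one hφ
  obtain ⟨n, hn, hn'⟩ := ih (contractionC h) hX' hfin'
    (fun j hj => have := hb j hj; (hρs j).subsingleton)
    (by
      refine lt_of_lt_of_le (Finset.sum_lt_sum (fun j _ => ?_)
        ⟨i, Finset.mem_range.2 hiN, ?_⟩) (Nat.lt_succ_iff.1 hk)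
      · have := hfin j
        exact LinearMap.finrank_le_finrank_of_surjective (hρs j)
      · have := hfin i
        have := hfin' i
        have := hX' i
        have : Module.Free R ((contractionC h).X i) := Module.free_of_flat_of_isLocalRing
        -- `X_i` maps onto the complement plus a copy of `R` spanned by `d e`, so the rank in degree
        -- `i` drops.
        have hs : Function.Surjective ((ρ i).prod φ) := by
          rintro ⟨x, r⟩
          have h0 : φ (((contractionι h).f i).hom x) = 0 := by
            have : φ x.1 • e = 0 := (hi x.1).symm.trans x.2.1
            have := congrArg (fun z => φ ((X.d (i + 1) i).hom z)) this
            simp only [map_smul, hφ, smul_eq_mul, mul_one, map_zero] at this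
            exact this
          have h1 : ρ i ((X.d (i + 1) i).hom e) = 0 := by
            refine contractionι_injective h i ?_
            have h2 : afterD h i ((X.d (i + 1) i).hom e) = 0 := by
              cases i with
              | zero => rfl
              | succ i =>
                change h i ((X.d (i + 1) i).hom _) = 0
                rw [d_d_apply, map_zero]
            rw [hρ', hi, hφ, h2, one_smul, sub_self, sub_zero, map_zero]
          refine ⟨((contractionι h).f i).hom x + r • (X.d (i + 1) i).hom e, Prod.ext ?_ ?_⟩
          · change ρ i _ = x
            rw [map_add, map_smul, hρ, h1, smul_zero, add_zero]
          · change φ _ = r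
            rw [map_add, map_smul, hφ, h0, zero_add, smul_eq_mul, mul_one]
        have := LinearMap.finrank_le_finrank_of_surjective hs
        rw [Module.finrank_prod, Module.finrank_self] at this
        omega)
    -- In degree 0 the projection is `1 - d h`, so it changes `x₀` only by a boundary.
    ⟨ρ 0 x₀, fun y hy => hx₀ (((contractionι h).f 1).hom y + h 0 x₀) (by
      rw [map_add, hom_d_apply, hy, hρ']
      change x₀ - _ - 0 + _ = _
      abel)⟩
  refine ⟨n, (IsCellular.weakEquiv_source _ (quasiIso_contractionι h₁ h₂) .self).trans hn,
    fun x => ?_⟩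
  obtain ⟨g, y', hg⟩ := hn' (ρ 0 x)
  refine ⟨g ≫ contractionι h, ((contractionι h).f 1).hom y' + h 0 x, ?_⟩
  have := hρ' 0 x
  rw [hg, map_add, ← hom_d_apply] at this
  rw [comp_f_apply, map_add, ← add_assoc, this]
  change _ = x - _ - 0 + _
  abel

/-! ### Finiteness of perfect complexes -/

theorem IsPerfect.finite_X {X : Ch R} (hX : IsPerfect X) (i : ℕ) : Module.Finite R (X.X i) := by
  have := hX.finite
  exact Module.Finite.of_surjective (DirectSum.component R ℕ (fun n => (X.X n : Type u)) i)
    fun x => ⟨DirectSum.lof R ℕ (fun n => (X.X n : Type u)) i x,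
      DirectSum.component.lof_self (M := fun n => (X.X n : Type u)) R i x⟩

theorem IsPerfect.exists_bound {X : Ch R} (hX : IsPerfect X) :
    ∃ N, ∀ i ≥ N, Subsingleton (X.X i) := by
  classical
  obtain ⟨s, hs⟩ := hX.finite.fg_top
  let M := fun n => (X.X n : Type u)
  -- Beyond the supports of the finitely many generators all terms vanish.
  let N := s.sup fun x => (DFinsupp.support x).sup id + 1
  refine ⟨N, fun i hi => subsingleton_of_forall_eq 0 fun x => ?_⟩
  have h0 : LinearMap.ker (DirectSum.component R ℕ M i) = ⊤ := by
    rw [eq_top_iff, ← hs, Submodule.span_le]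
    intro y hy
    rw [SetLike.mem_coe, LinearMap.mem_ker]
    change y i = 0
    by_contra h
    have h1 : i ≤ (DFinsupp.support y).sup id :=
      Finset.le_sup (f := id) (DFinsupp.mem_support_iff.2 h)
    have h2 : (DFinsupp.support y).sup id + 1 ≤ N :=
      Finset.le_sup (f := fun x : DirectSum ℕ M => (DFinsupp.support x).sup id + 1) hy
    omega
  have : DirectSum.lof R ℕ M i x ∈ LinearMap.ker (DirectSum.component R ℕ M i) :=
    h0 ▸ Submodule.mem_top
  rw [LinearMap.mem_ker, DirectSum.component.lof_self] at this
  exact this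

/-! ### Generation of homology in degree zero -/

/-- Every class in degree zero of `Y` is a combination of images of classes of `X`. -/
def IsGeneratedBy (X Y : Ch R) : Prop :=
  Submodule.span R {y : Y.X 0 | ∃ (g : X ⟶ Y) (x : X.X 0), (g.f 0).hom x = y} ⊔
    LinearMap.range (Y.d 1 0).hom = ⊤

theorem IsGeneratedBy.iff_exists {X Y : Ch R} : IsGeneratedBy X Y ↔
    ∃ (I : Type u) (f : (∐ fun _ : I => X) ⟶ Y),
      Epi (HomologicalComplex.homologyMap f 0) := by
  constructor
  · intro h
    -- The universal choice: one copy of `X` for every chain map.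
    refine ⟨X ⟶ Y, Sigma.desc id, ?_⟩
    rw [epi_homologyMap_zero_iff]
    intro w
    have hle : Submodule.span R {y : Y.X 0 | ∃ (g : X ⟶ Y) (x : X.X 0), (g.f 0).hom x = y} ≤
        LinearMap.range ((Sigma.desc id : (∐ fun _ : (X ⟶ Y) => X) ⟶ Y).f 0).hom := by
      rw [Submodule.span_le]
      rintro _ ⟨g, x, rfl⟩
      refine ⟨((Sigma.ι (fun _ : (X ⟶ Y) => X) g).f 0).hom x, ?_⟩
      rw [← comp_f_apply, Sigma.ι_desc]
      rfl
    obtain ⟨a, ha, _, ⟨b, rfl⟩, rfl⟩ := Submodule.mem_sup.1 (h ▸ Submodule.mem_top : w ∈ _)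
    obtain ⟨v, rfl⟩ := hle ha
    exact ⟨v, b, rfl⟩
  · rintro ⟨I, f, hf⟩
    rw [epi_homologyMap_zero_iff] at hf
    refine eq_top_iff.2 fun w _ => ?_
    obtain ⟨v, w', rfl⟩ := hf w
    refine Submodule.add_mem_sup ?_ ⟨w', rfl⟩
    have hv : v ∈ ⨆ i, LinearMap.range ((Sigma.ι (fun _ : I => X) i).f 0).hom := by
      rw [iSup_range_ι_eq_top]
      exact Submodule.mem_top
    rw [← Submodule.mem_comap]
    revert hv
    refine fun hv => (iSup_le fun i => ?_ : _ ≤ Submodule.comap (f.f 0).hom _) hv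
    rintro _ ⟨x, rfl⟩
    exact Submodule.subset_span ⟨Sigma.ι (fun _ : I => X) i ≫ f, x, rfl⟩

theorem IsGeneratedBy.map {X V W : Ch R} (h : IsGeneratedBy X V) (f : V ⟶ W)
    (hf : ∀ w, ∃ v w', w = (f.f 0).hom v + (W.d 1 0).hom w') : IsGeneratedBy X W := by
  refine eq_top_iff.2 fun w _ => ?_
  obtain ⟨v, w', rfl⟩ := hf w
  refine add_mem ?_ (Submodule.mem_sup_right ⟨w', rfl⟩)
  obtain ⟨a, ha, _, ⟨b, rfl⟩, rfl⟩ := Submodule.mem_sup.1 (h ▸ Submodule.mem_top : v ∈ _)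
  rw [map_add, ← hom_d_apply]
  refine Submodule.add_mem_sup ?_ ⟨_, rfl⟩
  rw [← Submodule.mem_comap]
  refine (Submodule.span_le.2 ?_ : _ ≤ Submodule.comap (f.f 0).hom _) ha
  rintro _ ⟨g, x, rfl⟩
  exact Submodule.subset_span ⟨g ≫ f, x, rfl⟩

theorem surjective_of_quasiIso {V W : Ch R} (f : V ⟶ W) (hf : QuasiIso f) (w : W.X 0) :
    ∃ v w', w = (f.f 0).hom v + (W.d 1 0).hom w' := by
  have := ((quasiIso_iff_bijective f).1 hf 0).2
  rw [homologyMap_surjective_iff] at this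
  obtain ⟨v, -, h⟩ := this w (isCycle_zero _ _)
  exact ⟨v, h⟩

/-! ### Lifting along weak equivalences -/

/-- Maps from a cofibrant complex lift along surjective weak equivalences. -/
theorem exists_lift_of_surjective {X V W : Ch R} (hX : IsCofibrant X) (q : V ⟶ W)
    (hq : QuasiIso q) (hs : ∀ i, Function.Surjective (q.f i).hom) (g : X ⟶ W) :
    ∃ h : X ⟶ V, h ≫ q = g := by
  have hinj (i) := (homologyMap_injective_iff q i).1 ((quasiIso_iff_bijective q).1 hq i).1
  have hsurj (i) := (homologyMap_surjective_iff q i).1 ((quasiIso_iff_bijective q).1 hq i).2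
  have key (i) (w : W.X (i + 1)) (c : V.X i) (hc : IsCycle V i c)
      (hwc : (W.d (i + 1) i).hom w = (q.f i).hom c) :
      ∃ v, (q.f (i + 1)).hom v = w ∧ (V.d (i + 1) i).hom v = c := by
    obtain ⟨v, rfl⟩ := hinj i c hc w hwc
    rw [← hom_d_apply] at hwc
    obtain ⟨z, hz, w', hw'⟩ := hsurj (i + 1) (w - (q.f (i + 1)).hom v)
      (isCycle_succ (by rw [map_sub, hwc, sub_self]))
    obtain ⟨v', rfl⟩ := hs (i + 2) w'
    refine ⟨v + z + (V.d (i + 2) (i + 1)).hom v', ?_, ?_⟩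
    · rw [map_add, map_add, ← hom_d_apply, add_assoc, ← hw', add_sub_cancel]
    · rw [map_add, map_add, d_d_apply, hz i, add_zero, add_zero]
  -- The lift is built degree by degree; the second condition, that `h ∘ d` lands in cycles, is what
  -- allows the next step.
  let St (n : ℕ) := {h : X.X n →ₗ[R] V.X n //
    (∀ x, (q.f n).hom (h x) = (g.f n).hom x) ∧
      ∀ x, IsCycle V n (h ((X.d (n + 1) n).hom x))}
  have step (n) (s : St n) : ∃ t : St (n + 1), ∀ x,
      (V.d (n + 1) n).hom (t.1 x) = s.1 ((X.d (n + 1) n).hom x) := by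
    have := hX (n + 1)
    let G : V.X (n + 1) →ₗ[R] (W.X (n + 1) × V.X n) :=
      (q.f (n + 1)).hom.prod (V.d (n + 1) n).hom
    let H : X.X (n + 1) →ₗ[R] (W.X (n + 1) × V.X n) :=
      (g.f (n + 1)).hom.prod (s.1 ∘ₗ (X.d (n + 1) n).hom)
    have hGH (x) : H x ∈ LinearMap.range G := by
      obtain ⟨v, hv, hv'⟩ := key n ((g.f (n + 1)).hom x) (s.1 ((X.d (n + 1) n).hom x))
        (s.2.2 x) (by rw [s.2.1, hom_d_apply])
      exact ⟨v, Prod.ext hv hv'⟩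
    obtain ⟨t, ht⟩ := Module.projective_lifting_property G.rangeRestrict
      (H.codRestrict (LinearMap.range G) hGH) (LinearMap.surjective_rangeRestrict G)
    have ht' (x) : G (t x) = H x := congrArg Subtype.val (LinearMap.congr_fun ht x)
    have h1 (x) : (V.d (n + 1) n).hom (t x) = s.1 ((X.d (n + 1) n).hom x) :=
      congrArg Prod.snd (ht' x)
    refine ⟨⟨t, fun x => congrArg Prod.fst (ht' x), fun x => isCycle_succ ?_⟩, h1⟩
    rw [h1, d_d_apply, map_zero]
  have base : Nonempty (St 0) := by
    have := hX 0
    obtain ⟨t, ht⟩ := Module.projective_lifting_property (q.f 0).hom (g.f 0).hom (hs 0)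
    exact ⟨⟨t, LinearMap.congr_fun ht, fun x => isCycle_zero _ _⟩⟩
  choose nxt hnxt using step
  let s : ∀ n, St n := fun n => Nat.rec base.some (fun n s => nxt n s) n
  refine ⟨homMk (fun n => (s n).1) fun n x => hnxt n (s n) x, hom_ext_apply fun n x => ?_⟩
  exact (s n).2.1 x

/-- Maps from a cofibrant complex lift along weak equivalences up to homology in degree zero. -/
theorem exists_lift_of_quasiIso {X V W : Ch R} (hX : IsCofibrant X) (q : V ⟶ W)
    (hq : QuasiIso q) (g : X ⟶ W) :
    ∃ h : X ⟶ V, ∀ x, ∃ w', (g.f 0).hom x = (q.f 0).hom ((h.f 0).hom x) +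
      (W.d 1 0).hom w' := by
  -- `q` factors through `V × P`, weakly equivalent to `V`, by a surjective weak equivalence.
  -- Dropping the `P`-component changes degree 0 by a boundary, since `P` is acyclic.
  obtain ⟨P, r, hP, hr⟩ := exists_path W
  let ι : V ⟶ prodC V P := homMk (W := prodC V P) (fun i => LinearMap.inl R (V.X i) (P.X i))
    fun i x => Prod.ext rfl (map_zero (P.d (i + 1) i).hom)
  let π : prodC V P ⟶ V := homMk (V := prodC V P) (fun i => LinearMap.fst R (V.X i) (P.X i))
    fun i x => rfl
  have hι : QuasiIso ι := by
    refine quasiIso_of_injective ι (fun i x y h => congrArg Prod.fst h) ?_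
    rintro i ⟨x, y⟩ h
    obtain ⟨z, rfl⟩ := hP i y fun j => by
      obtain ⟨v, hv⟩ := h j
      exact (congrArg Prod.snd hv).symm
    refine ⟨((0, z) : V.X (i + 1) × P.X (i + 1)), x, Prod.ext ?_ (zero_add _).symm⟩
    change x = x + (V.d (i + 1) i).hom 0
    rw [map_zero, add_zero]
  have hc : ι ≫ prodDesc q r = q := hom_ext_apply fun i x => by
    rw [comp_f_apply]
    refine (prodDesc_apply q r i x 0).trans ?_
    rw [map_zero, add_zero]
  have hqr : QuasiIso (prodDesc q r) := by
    rw [← hc] at hq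
    exact quasiIso_of_comp_left ι _
  obtain ⟨h, hh⟩ := exists_lift_of_surjective hX (prodDesc q r) hqr (fun i w => by
    rcases i with _ | i
    · obtain ⟨v, w', rfl⟩ := surjective_of_quasiIso q hq w
      obtain ⟨z, rfl⟩ := hr 0 w'
      exact ⟨((v, (P.d 1 0).hom z) : V.X 0 × P.X 0), by rw [prodDesc_apply, hom_d_apply]⟩
    · obtain ⟨z, rfl⟩ := hr i w
      exact ⟨((0, z) : V.X (i + 1) × P.X (i + 1)), by
        rw [prodDesc_apply, map_zero, zero_add]⟩) g
  refine ⟨h ≫ π, fun x => ?_⟩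
  obtain ⟨z, hz⟩ := hP 0 ((h.f 0).hom x : V.X 0 × P.X 0).2 (isCycle_zero _ _)
  refine ⟨(r.f 1).hom z, ?_⟩
  rw [hom_d_apply, hz, ← hh]
  rfl

/-! ### The two implications -/

theorem IsCellular.isGeneratedBy {X Y : Ch R} (hX : IsCofibrant X) (hY : IsCellular X Y) :
    IsGeneratedBy X Y := by
  induction hY with
  | self =>
    refine eq_top_iff.2 fun x _ => Submodule.mem_sup_left (Submodule.subset_span ⟨𝟙 X, x, rfl⟩)
  | sum I W _ ih =>
    refine eq_top_iff.2 ?_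
    rw [← iSup_range_ι_eq_top W 0, iSup_le_iff]
    rintro i _ ⟨x, rfl⟩
    obtain ⟨a, ha, _, ⟨b, rfl⟩, rfl⟩ := Submodule.mem_sup.1 (ih i ▸ Submodule.mem_top : x ∈ _)
    rw [map_add, ← hom_d_apply]
    refine Submodule.add_mem_sup ?_ ⟨_, rfl⟩
    rw [← Submodule.mem_comap]
    refine (Submodule.span_le.2 ?_ : _ ≤ Submodule.comap ((Sigma.ι W i).f 0).hom _) ha
    rintro _ ⟨g, x, rfl⟩
    exact Submodule.subset_span ⟨g ≫ Sigma.ι W i, x, rfl⟩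
  | weakEquiv_target f hf _ ih => exact ih.map f (surjective_of_quasiIso f hf)
  | @weakEquiv_source V W f hf _ ih =>
    refine eq_top_iff.2 fun v _ => ?_
    let T := Submodule.span R {y : V.X 0 | ∃ (g : X ⟶ V) (x : X.X 0), (g.f 0).hom x = y} ⊔
      LinearMap.range (V.d 1 0).hom
    have hT : Submodule.span R {y : W.X 0 | ∃ (g : X ⟶ W) (x : X.X 0), (g.f 0).hom x = y} ≤
        T.map (f.f 0).hom ⊔ LinearMap.range (W.d 1 0).hom := by
      rw [Submodule.span_le]
      rintro _ ⟨g, x, rfl⟩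
      obtain ⟨h, hh⟩ := exists_lift_of_quasiIso hX f hf g
      obtain ⟨w', hw'⟩ := hh x
      rw [hw']
      exact Submodule.add_mem_sup (Submodule.mem_map_of_mem
        (Submodule.mem_sup_left (Submodule.subset_span ⟨h, x, rfl⟩))) ⟨w', rfl⟩
    have hmem : (f.f 0).hom v ∈ T.map (f.f 0).hom ⊔ LinearMap.range (W.d 1 0).hom := by
      refine (sup_le hT le_sup_right :
        _ ⊔ LinearMap.range (W.d 1 0).hom ≤ _) (ih ▸ Submodule.mem_top)
    -- The images of `v` and of the generated element `t` differ by a boundary, so injectivity on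
    -- `H₀` makes `v - t` a boundary.
    obtain ⟨_, ⟨t, ht, rfl⟩, _, ⟨w', rfl⟩, hw⟩ := Submodule.mem_sup.1 hmem
    obtain ⟨v', hv'⟩ := (homologyMap_injective_iff f 0).1
      ((quasiIso_iff_bijective f).1 hf 0).1 (v - t) (isCycle_zero _ _) w' (by
        rw [map_sub, ← hw, add_sub_cancel_left])
    rw [← sub_add_cancel v t, ← hv', add_comm]
    exact add_mem ht (Submodule.mem_sup_right ⟨v', rfl⟩)
  | quotient S hS _ _ _ ih =>
    refine ih.map S.g fun w => ?_
    have := hS.epi_g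
    have : Epi (S.g.f 0) := inferInstance
    obtain ⟨v, hv⟩ := (ModuleCat.epi_iff_surjective _).1 this w
    exact ⟨v, 0, by rw [map_zero, add_zero]; exact hv.symm⟩

/-- Cellularity with respect to a perfect complex is detected on homology in degree zero. -/
theorem isCellular_iff_exists_epi [IsLocalRing R]
    (hprincipal : (IsLocalRing.maximalIdeal R).IsPrincipal)
    (hsq : IsLocalRing.maximalIdeal R ^ 2 = ⊥)
    (X : Ch R) (hX : IsPerfect X)
    (hH : ¬ IsZero (X.homology 0)) (Y : Ch R) :
    IsCellular X Y ↔
      ∃ (I : Type u) (f : (∐ fun _ : I => X) ⟶ Y),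
        Epi (HomologicalComplex.homologyMap f 0) := by
  rw [← IsGeneratedBy.iff_exists]
  refine ⟨fun h => h.isGeneratedBy hX.isCofibrant, fun h => ?_⟩
  obtain ⟨p, hm⟩ := hprincipal.principal
  have hp : p * p = 0 := by
    have hpm : p ∈ IsLocalRing.maximalIdeal R := hm ▸ Submodule.mem_span_singleton_self p
    have := Ideal.mul_mem_mul hpm hpm
    rwa [← pow_two, hsq, Ideal.mem_bot] at this
  obtain ⟨N, hN⟩ := hX.exists_bound
  obtain ⟨n, hn, hn'⟩ := exists_seg_of_finite hp hm N _ X hX.isCofibrant hX.finite_X hN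
    (Nat.lt_succ_self _) ((not_isZero_homology_zero_iff X).1 hH)
  refine hn.of_seg hm fun y => ?_
  -- Maps out of the segment can be added and scaled, so the elements hit by a single map, up to
  -- boundaries, already form a submodule.
  let T : Submodule R (Y.X 0) :=
    { carrier := {y | ∃ (g : seg R p hp (· ≤ n) ⟶ Y) (y' : Y.X 1),
        y = (g.f 0).hom (segMk R p hp (· ≤ n) 0 1) + (Y.d 1 0).hom y'}
      zero_mem' := ⟨0, 0, by simp⟩
      add_mem' := by
        rintro _ _ ⟨g, y, rfl⟩ ⟨g', y', rfl⟩
        refine ⟨g + g', y + y', ?_⟩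
        rw [map_add]
        change _ = (g.f 0).hom _ + (g'.f 0).hom _ + _
        abel
      smul_mem' := by
        rintro r _ ⟨g, y, rfl⟩
        refine ⟨r • g, r • y, ?_⟩
        rw [map_smul, smul_add]
        rfl }
  have hT : T = ⊤ := by
    refine top_le_iff.1 (h ▸ sup_le (Submodule.span_le.2 ?_) ?_)
    · rintro _ ⟨f, x, rfl⟩
      obtain ⟨g, x', rfl⟩ := hn' x
      exact ⟨g ≫ f, (f.f 1).hom x', by rw [map_add, ← hom_d_apply]; rfl⟩
    · rintro _ ⟨y', rfl⟩
      exact ⟨0, y', by simp⟩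
  exact (hT ▸ Submodule.mem_top : y ∈ T)

end CellularComplexes

theorem proposition5p2 {R : Type u} [CommRing R] [IsLocalRing R]
    (hprincipal : (IsLocalRing.maximalIdeal R).IsPrincipal)
    (hsq : IsLocalRing.maximalIdeal R ^ 2 = ⊥)
    (X : CellularComplexes.Ch R) (hX : CellularComplexes.IsPerfect X)
    (hH : ¬ IsZero (X.homology 0)) (Y : CellularComplexes.Ch R) :
    CellularComplexes.IsCellular X Y ↔
      ∃ (I : Type u) (f : (∐ fun _ : I => X) ⟶ Y),
        Epi (HomologicalComplex.homologyMap f 0) :=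
  CellularComplexes.isCellular_iff_exists_epi hprincipal hsq X hX hH Y
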